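/- Fix $T>0$ and a compact, possibly empty, set $\mathcal S\subset\mathbb R^3$, and write $\mathcal S^c=\mathbb R^3\setminus\mathcal S$. Let $A\in C^1(\mathbb R\times\mathbb R^3;\mathbb R^3)$ be $T$-periodic in its first variable $t$, with $\partial_tA\not\equiv0$ and $$\lim_{|x|\to\infty}\big(|\partial_tA(t,x)|+|\nabla A(t,x)|\big)=0\quad\text{uniformly in }t.$$ Let $\Phi:\mathbb R\times\mathcal S^c\to\mathbb R$ be bounded from above, $T$-periodic and continuous in $t$, with $\Phi(t,\cdot)\in C^1(\mathcal S^c)$ for every $t$, with $\nabla\Phi$ (the gradient in $x$) continuous on $\mathbb R\times\mathcal S^c$, and with $\lim_{|x|\to\infty}|\nabla\Phi(t,x)|=0$ uniformly in $t$. Suppose moreover that for every $x_0\in\partial\mathcal S$ and $t_0\in[0,T]$ there exist $\varepsilon,r>0$ such that $$-\Phi(t,x)\ge\frac{r}{|x-x_0|}\quad\text{for all }(t,x)\in\mathbb R\times\mathcal S^c\text{ with }|x-x_0|<\varepsilon,\ |t-t_0|<\varepsilon.$$ Finally suppose that $\partial_tA+\nabla\Phi\not\equiv0$ on $\mathbb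 R\times\mathcal S^c$. Put $\varphi(x)=\int_0^T\Phi(t,x)\,dt$ for $x\in\mathcal S^c$. Suppose that there is a point $b\in\mathcal S^c$ with $\varphi(b)=\max_{\mathcal S^c}\varphi$ such that $\partial_tA(t,b)\neq-\nabla\Phi(t,b)$ for at least one $t$. Then, with $E=-\partial_tA-\nabla\Phi$ and $B=\nabla\times A$, the Lorentz force equation $$\frac{d}{dt}\left(\frac{\dot q(t)}{\sqrt{1-|\dot q(t)|^2}}\right)=E(t,q(t))+\dot q(t)\times B(t,q(t))$$ has at least one non-constant $T$-periodic solution, that is, a non-constant $T$-periodic $q\in C^2(\mathbb R;\mathcal S^c)$ with $\|\dot q\|_\infty<1$ that satisfies the equation for all $t$. Moreover, if $\mathcal S=\emptyset$, then there is $\rho\in(0,1)$ (depending only on $T$, $A$, $\Phi$) such that every $T$-periodic solution $q$ of the equation satisfies $\|\dot q\|_\infty<\rho$. -/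

import Mathlib

noncomputable section

namespace LorentzForce

/-- Physical space `ℝ³` with its Euclidean norm. -/
abbrev Space : Type := EuclideanSpace ℝ (Fin 3)

/-- The vector product `u × v` on `ℝ³`. -/
def cross (u v : Space) : Space :=
  WithLp.toLp 2 (crossProduct (WithLp.ofLp u) (WithLp.ofLp v))

/-- The partial derivative `∂ⱼ Fᵢ` at `x` of a vector field `F` on `ℝ³`. -/
def partialD (F : Space → Space) (j i : Fin 3) (x : Space) : ℝ :=
  (fderiv ℝ F x (EuclideanSpace.single j 1)) i

/-- The rotational `∇ × F` of a vector field on `ℝ³`. -/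
def curl (F : Space → Space) (x : Space) : Space :=
  !₂[partialD F 1 2 x - partialD F 2 1 x,
     partialD F 2 0 x - partialD F 0 2 x,
     partialD F 0 1 x - partialD F 1 0 x]

/-- The time derivative `∂ₜ A (t, x)` of a time-dependent vector field. -/
def timeDeriv (A : ℝ → Space → Space) (t : ℝ) (x : Space) : Space :=
  deriv (fun s => A s x) t

/-- The electric field `E = -∂ₜ A - ∇ Φ`. -/
def electricField (A : ℝ → Space → Space) (Φ : ℝ → Space → ℝ) (t : ℝ) (x : Space) : Space :=
  -timeDeriv A t x - gradient (Φ t) x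

/-- The magnetic field `B = ∇ × A`. -/
def magneticField (A : ℝ → Space → Space) (t : ℝ) (x : Space) : Space :=
  curl (A t) x

/-- The class `𝒜` of vector potentials: of class `C¹` on `ℝ × ℝ³`, `T`-periodic in time,
non-autonomous, with derivatives decaying at spatial infinity uniformly in time. -/
structure IsVectorPotential (T : ℝ) (A : ℝ → Space → Space) : Prop where
  contDiff : ContDiff ℝ 1 (fun p : ℝ × Space => A p.1 p.2)
  periodic : ∀ t x, A (t + T) x = A t x
  nonautonomous : ∃ t x, timeDeriv A t x ≠ 0
  decay : ∀ ε > 0, ∃ R : ℝ, ∀ (t : ℝ) (x : Space), R ≤ ‖x‖ →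
    ‖timeDeriv A t x‖ + ‖fderiv ℝ (A t) x‖ < ε

/-- The class `𝒫` of scalar potentials with singular set `S`. Only the values of `Φ` on
`ℝ × Sᶜ` matter. At the boundary of `S` the potential has at least Coulomb strength. -/
structure IsScalarPotential (T : ℝ) (S : Set Space) (Φ : ℝ → Space → ℝ) : Prop where
  bddAbove : ∃ C : ℝ, ∀ t, ∀ x ∈ Sᶜ, Φ t x ≤ C
  periodic : ∀ t, ∀ x ∈ Sᶜ, Φ (t + T) x = Φ t x
  continuous_time : ∀ x ∈ Sᶜ, Continuous (fun t => Φ t x)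
  contDiffOn : ∀ t, ContDiffOn ℝ 1 (Φ t) Sᶜ
  continuousOn_gradient :
    ContinuousOn (fun p : ℝ × Space => gradient (Φ p.1) p.2) (Set.univ ×ˢ Sᶜ)
  decay : ∀ ε > 0, ∃ R : ℝ, ∀ (t : ℝ), ∀ x ∈ Sᶜ, R ≤ ‖x‖ → ‖gradient (Φ t) x‖ < ε
  singular : ∀ x₀ ∈ frontier S, ∀ t₀ ∈ Set.Icc 0 T, ∃ ε > 0, ∃ r > 0,
    ∀ (t : ℝ), ∀ x ∈ Sᶜ, ‖x - x₀‖ < ε → |t - t₀| < ε → r / ‖x - x₀‖ ≤ -Φ t x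

/-- Admissible pairs of potentials: `A ∈ 𝒜`, `Φ ∈ 𝒫`, and the electric field they generate
does not vanish identically. -/
structure IsAdmissible (T : ℝ) (S : Set Space) (A : ℝ → Space → Space)
    (Φ : ℝ → Space → ℝ) : Prop where
  vector : IsVectorPotential T A
  scalar : IsScalarPotential T S Φ
  electric : ∃ t, ∃ x ∈ Sᶜ, timeDeriv A t x + gradient (Φ t) x ≠ 0

/-- The function `φ(x) = ∫₀ᵀ Φ(t, x) dt`. -/
def meanPotential (T : ℝ) (Φ : ℝ → Space → ℝ) (x : Space) : ℝ :=
  ∫ t in (0 : ℝ)..T, Φ t x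

/-- The set `M_Φ` of the points of `Sᶜ` at which `φ` attains its maximum over `Sᶜ`. -/
def maxSet (T : ℝ) (S : Set Space) (Φ : ℝ → Space → ℝ) : Set Space :=
  {b | b ∈ Sᶜ ∧ ∀ x ∈ Sᶜ, meanPotential T Φ x ≤ meanPotential T Φ b}

/-- The relativistic momentum `q̇ / √(1 - |q̇|²)` along a trajectory. -/
def momentum (q : ℝ → Space) (t : ℝ) : Space :=
  (√(1 - ‖deriv q t‖ ^ 2))⁻¹ • deriv q t

/-- `T`-periodic solutions of the Lorentz force equation
`d/dt (q̇ / √(1 - |q̇|²)) = E(t, q) + q̇ × B(t, q)`. As `q̇` is continuous and periodic,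
`|q̇(t)| < 1` for every `t` is the same as `‖q̇‖_∞ < 1`. -/
structure IsPeriodicSolution (T : ℝ) (S : Set Space) (A : ℝ → Space → Space)
    (Φ : ℝ → Space → ℝ) (q : ℝ → Space) : Prop where
  contDiff : ContDiff ℝ 2 q
  periodic : ∀ t, q (t + T) = q t
  mem : ∀ t, q t ∈ Sᶜ
  speed : ∀ t, ‖deriv q t‖ < 1
  equation : ∀ t, HasDerivAt (momentum q)
    (electricField A Φ t (q t) + cross (deriv q t) (magneticField A t (q t))) t

end LorentzForce

end

/-! The proof is a direct method for the action, the integral over `[0, T]` of `1 - √(1 - |q̇|²) +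
⟪q̇, A⟫ - Φ`, on closed `C¹` curves in `Sᶜ` of speed at most one. Its infimum `m` is finite: a
closed curve makes the integral of `⟪q̇, A⟫` controllable by the derivatives of `A` alone, and `Φ`
is bounded above.

The infimum lies strictly below `-φ(b)`, the action of the constant curve `b`. Were they equal, that
curve would be minimizing, hence a solution, and the electric field would vanish at `b` at all
times. The gap gives compactness. Curves starting far away have action at least about `-φ(q 0) ≥
-φ(b)` (`exists_le_action_of_le_norm`). Curves of bounded action keep a fixed distance from `S`,
because a curve of speed at most one that comes close to `S` makes a Coulomb singularity contribute
a logarithmically divergent integral (`exists_le_dist_of_action_le`).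

The kinetic term is not differentiable at unit speed, so an Euler equation is not derived for a
minimizer. Instead, almost minimizers satisfy an approximate variational inequality that
differentiates only the interaction and uses convexity for the rest (`exists_integral_kinetic_le`).
Along a minimizing sequence, positions and integrated forces converge uniformly by Arzelà–Ascoli.
These limits determine a candidate momentum `P` up to a constant, which is fixed by requiring the
velocity of `P` to have mean zero. Testing with the primitive of that velocity, strong convexity
forces the velocities to converge in `L²` (`tendsto_integral_sq_sub_velocity`). The limit therefore
satisfies the integrated equation with a momentum that is finite everywhere, hence with speed below
one (`exists_isExtremal`), and extends periodically to a solution. It is never necessary to compute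
the action of this limit: if it were constant, equal to `c`, the convergence would give `m ≥ -φ(c) ≥
-φ(b) > m`.

For `S = ∅` the fields are bounded. Rolle's theorem for the component of `q` along the momentum at
one time bounds the momentum of every periodic solution (`IsPeriodicSolution.norm_momentum_le`), and
a bounded momentum keeps the speed away from one. -/

noncomputable section

open Set Filter Topology MeasureTheory
open scoped RealInnerProductSpace NNReal

namespace LorentzForce

/-! ### Relativistic kinetic energy and momentum -/

/-- The relativistic kinetic energy density `1 - √(1 - |u|²)`. -/
def kinetic (u : Space) : ℝ := 1 - √(1 - ‖u‖ ^ 2)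

/-- The velocity `p / √(1 + |p|²)` belonging to a relativistic momentum `p`. -/
def velocity (p : Space) : Space := (√(1 + ‖p‖ ^ 2))⁻¹ • p

lemma continuous_kinetic : Continuous kinetic := by unfold kinetic; fun_prop

lemma sqrt_one_add_pos (p : Space) : 0 < √(1 + ‖p‖ ^ 2) := by positivity

lemma continuous_velocity : Continuous velocity := by
  unfold velocity
  refine Continuous.smul (Continuous.inv₀ (by fun_prop) fun p => (sqrt_one_add_pos p).ne') continuous_id

lemma norm_velocity_sq (p : Space) : ‖velocity p‖ ^ 2 = 1 - (1 + ‖p‖ ^ 2)⁻¹ := by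
  have h : (0 : ℝ) < 1 + ‖p‖ ^ 2 := by positivity
  rw [velocity, norm_smul, mul_pow, norm_inv, Real.norm_of_nonneg (Real.sqrt_nonneg _), inv_pow,
    Real.sq_sqrt h.le]
  field_simp
  ring

lemma sqrt_one_sub_velocity (p : Space) : √(1 - ‖velocity p‖ ^ 2) = (√(1 + ‖p‖ ^ 2))⁻¹ := by
  rw [norm_velocity_sq, sub_sub_cancel, Real.sqrt_inv]

lemma norm_velocity_lt_one (p : Space) : ‖velocity p‖ < 1 := by
  have h : (0 : ℝ) < (1 + ‖p‖ ^ 2)⁻¹ := by positivity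
  have := norm_velocity_sq p
  nlinarith [norm_nonneg (velocity p)]

lemma momentum_velocity (p : Space) :
    (√(1 - ‖velocity p‖ ^ 2))⁻¹ • velocity p = p := by
  rw [sqrt_one_sub_velocity, inv_inv, velocity, smul_smul, mul_inv_cancel₀ (sqrt_one_add_pos p).ne',
    one_smul]

lemma velocity_momentum {u : Space} (hu : ‖u‖ < 1) :
    velocity ((√(1 - ‖u‖ ^ 2))⁻¹ • u) = u := by
  have h : 0 < 1 - ‖u‖ ^ 2 := by nlinarith [norm_nonneg u]
  have h' : 1 + ‖(√(1 - ‖u‖ ^ 2))⁻¹ • u‖ ^ 2 = (1 - ‖u‖ ^ 2)⁻¹ := by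
    rw [norm_smul, mul_pow, norm_inv, Real.norm_of_nonneg (Real.sqrt_nonneg _), inv_pow,
      Real.sq_sqrt h.le]
    field_simp
    ring
  rw [velocity, h', Real.sqrt_inv, inv_inv, smul_smul, mul_inv_cancel₀ (Real.sqrt_pos.2 h).ne',
    one_smul]

lemma contDiff_velocity : ContDiff ℝ 1 velocity := by
  unfold velocity
  have h : ContDiff ℝ 1 fun p : Space => √(1 + ‖p‖ ^ 2) :=
    ContDiff.sqrt (contDiff_const.add (contDiff_norm_sq ℝ)) fun p => by positivity
  exact (h.inv fun p => (sqrt_one_add_pos p).ne').smul contDiff_id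

lemma kinetic_nonneg (u : Space) : 0 ≤ kinetic u := by
  have : √(1 - ‖u‖ ^ 2) ≤ 1 := Real.sqrt_le_one.2 (by nlinarith [sq_nonneg ‖u‖])
  unfold kinetic; linarith

@[simp] lemma kinetic_zero : kinetic 0 = 0 := by simp [kinetic]

/-- The graph of `√(1 - |u|²)` is a hemisphere of the unit sphere in `ℝ⁴`. Its concavity reduces to
Cauchy–Schwarz for the unit vectors `(u, √(1 - |u|²))` and `(w, √(1 - |w|²))`. Speed one is allowed,
where the kinetic energy has no derivative. -/
lemma kinetic_convex {u w : Space} (hu : ‖u‖ ≤ 1) (hw : ‖w‖ ≤ 1) {s : ℝ} (h0 : 0 ≤ s)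
    (h1 : s ≤ 1) :
    kinetic (u + s • (w - u)) ≤ kinetic u + s * (kinetic w - kinetic u) := by
  have hu' : 0 ≤ 1 - ‖u‖ ^ 2 := by nlinarith [norm_nonneg u]
  have hw' : 0 ≤ 1 - ‖w‖ ^ 2 := by nlinarith [norm_nonneg w]
  have ha := Real.sq_sqrt hu'
  have hb := Real.sq_sqrt hw'
  have hi : ‖u - w‖ ^ 2 = ‖u‖ ^ 2 - 2 * ⟪u, w⟫ + ‖w‖ ^ 2 := norm_sub_sq_real u w
  have hn : ‖u + s • (w - u)‖ ^ 2 =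
      (1 - s) ^ 2 * ‖u‖ ^ 2 + 2 * (s * (1 - s)) * ⟪u, w⟫ + s ^ 2 * ‖w‖ ^ 2 := by
    rw [show u + s • (w - u) = (1 - s) • u + s • w by module, norm_add_sq_real, norm_smul,
      norm_smul, mul_pow, mul_pow, inner_smul_left, inner_smul_right]
    simp only [Real.norm_eq_abs, sq_abs, conj_trivial]
    ring
  have key : (1 - s) * √(1 - ‖u‖ ^ 2) + s * √(1 - ‖w‖ ^ 2) ≤ √(1 - ‖u + s • (w - u)‖ ^ 2) := by
    apply Real.le_sqrt_of_sq_le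
    rw [hn]
    have hss : 0 ≤ s * (1 - s) := mul_nonneg h0 (by linarith)
    have : √(1 - ‖u‖ ^ 2) * √(1 - ‖w‖ ^ 2) + ⟪u, w⟫ ≤ 1 := by
      nlinarith [sq_nonneg (√(1 - ‖u‖ ^ 2) - √(1 - ‖w‖ ^ 2)), sq_nonneg ‖u - w‖]
    nlinarith [mul_le_mul_of_nonneg_left this hss]
  unfold kinetic
  nlinarith

/-- Strong convexity of the kinetic energy, in Legendre dual form. -/
lemma kinetic_sub_inner_ge {u : Space} (hu : ‖u‖ ≤ 1) (p : Space) :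
    kinetic (velocity p) - ⟪velocity p, p⟫ + ‖u - velocity p‖ ^ 2 / 2 ≤ kinetic u - ⟪u, p⟫ := by
  have hu' : 0 ≤ 1 - ‖u‖ ^ 2 := by nlinarith [norm_nonneg u]
  have ha := Real.sq_sqrt hu'
  set a := √(1 - ‖u‖ ^ 2) with hadef
  set z := velocity p with hz
  set g := √(1 + ‖p‖ ^ 2) with hg
  have hgpos : 0 < g := sqrt_one_add_pos p
  have hg1 : 1 ≤ g := Real.one_le_sqrt.2 (by nlinarith [sq_nonneg ‖p‖])
  have hc : √(1 - ‖z‖ ^ 2) = g⁻¹ := sqrt_one_sub_velocity p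
  have hz1 := norm_velocity_lt_one p
  have hc2 : g⁻¹ ^ 2 = 1 - ‖z‖ ^ 2 := by
    rw [← hc]; exact Real.sq_sqrt (by nlinarith [norm_nonneg z])
  have hp : p = g • z := by
    rw [hz, velocity, smul_smul, mul_inv_cancel₀ hgpos.ne', one_smul]
  have hi : ‖u - z‖ ^ 2 = ‖u‖ ^ 2 - 2 * ⟪u, z⟫ + ‖z‖ ^ 2 := norm_sub_sq_real u z
  have h1 : ⟪z, p⟫ = g * ‖z‖ ^ 2 := by
    conv_lhs => rw [hp]
    rw [inner_smul_right, real_inner_self_eq_norm_sq]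
  have h2 : ⟪u, p⟫ = g * ⟪u, z⟫ := by
    conv_lhs => rw [hp]
    rw [inner_smul_right]
  have hgg : g * g⁻¹ = 1 := mul_inv_cancel₀ hgpos.ne'
  unfold kinetic
  rw [hc, h1, h2, ← hadef]
  -- Both `(u, a)` and `(z, g⁻¹)` are unit vectors of `ℝ⁴`, so one minus their inner product is half
  -- their squared distance. The factor `g ≥ 1` is then discarded.
  have e1 : g * (1 - ⟪u, z⟫ - a * g⁻¹) = g * ((‖u - z‖ ^ 2 + (a - g⁻¹) ^ 2) / 2) := by
    congr 1; nlinarith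
  have e2 : ‖u - z‖ ^ 2 / 2 ≤ g * ((‖u - z‖ ^ 2 + (a - g⁻¹) ^ 2) / 2) := by
    have : 0 ≤ (‖u - z‖ ^ 2 + (a - g⁻¹) ^ 2) / 2 := by positivity
    nlinarith [sq_nonneg (a - g⁻¹)]
  have e3 : g * ‖z‖ ^ 2 = g - g⁻¹ := by
    have : ‖z‖ ^ 2 = 1 - g⁻¹ ^ 2 := by linarith
    rw [this]; field_simp
  rw [e3]
  have e4 : g * (1 - ⟪u, z⟫ - a * g⁻¹) = g - g * ⟪u, z⟫ - a := by field_simp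
  linarith

/-! ### Analytic tools: the mean-zero shift, Arzelà–Ascoli, a logarithmic integral -/

/-- A family of velocities can be given mean zero by shifting the momenta. -/
lemma exists_integral_velocity_eq_zero {T : ℝ} (hT : 0 < T) {M : ℝ → Space} (hM : Continuous M) :
    ∃ l : Space, ∫ t in (0 : ℝ)..T, velocity (M t + l) = 0 := by
  -- The integral to be annihilated is the gradient of the coercive function `H`, so a minimizer of
  -- `H` will do.
  set H : Space → ℝ := fun l => ∫ t in (0 : ℝ)..T, √(1 + ‖M t + l‖ ^ 2) with hH
  have hcont : Continuous H := by
    apply intervalIntegral.continuous_parametric_intervalIntegral_of_continuous'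
    fun_prop
  obtain ⟨R, hR⟩ := isCompact_Icc.exists_bound_of_continuousOn (s := Icc 0 T) hM.continuousOn
  have hlow : ∀ l, T * (‖l‖ - R) ≤ H l := by
    intro l
    have : ∫ t in (0 : ℝ)..T, (‖l‖ - R) ≤ H l := by
      apply intervalIntegral.integral_mono_on hT.le (by simp)
        (Continuous.intervalIntegrable (by fun_prop) _ _)
      intro t ht
      have h1 : ‖l‖ ≤ ‖M t + l‖ + ‖M t‖ := by
        simpa using norm_sub_le (M t + l) (M t)
      have h2 : ‖M t + l‖ ≤ √(1 + ‖M t + l‖ ^ 2) := Real.le_sqrt_of_sq_le (by linarith)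
      linarith [hR t ht]
    rw [intervalIntegral.integral_const, sub_zero, smul_eq_mul] at this
    exact this
  have hlim : Tendsto H (cocompact Space) atTop := by
    refine tendsto_atTop_mono hlow ?_
    exact (tendsto_atTop_add_const_right _ (-R) (tendsto_norm_cocompact_atTop (E := Space))).const_mul_atTop hT
  obtain ⟨l, hl⟩ := hcont.exists_forall_le hlim
  refine ⟨l, ?_⟩
  have hvc : Continuous fun t => velocity (M t + l) := continuous_velocity.comp (by fun_prop)
  set W := ∫ t in (0 : ℝ)..T, velocity (M t + l) with hW
  -- A quadratic upper bound for `H` along the direction of its gradient `W` replaces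
  -- differentiation under the integral sign.
  have key : ∀ s : ℝ, 0 ≤ s * ‖W‖ ^ 2 + s ^ 2 * ‖W‖ ^ 2 * T / 2 := by
    intro s
    have h1 := hl (l + s • W)
    have h2 : H (l + s • W) ≤ ∫ t in (0 : ℝ)..T,
        (√(1 + ‖M t + l‖ ^ 2) + (s * ⟪W, velocity (M t + l)⟫ + s ^ 2 * ‖W‖ ^ 2 / 2)) := by
      apply intervalIntegral.integral_mono_on hT.le
        (Continuous.intervalIntegrable (by fun_prop) _ _)
        (Continuous.intervalIntegrable (by fun_prop) _ _)
      intro t _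
      set m := M t + l with hm
      have e : M t + (l + s • W) = m + s • W := by rw [hm]; module
      rw [e]
      set g := √(1 + ‖m‖ ^ 2) with hg
      have hgpos : 0 < g := sqrt_one_add_pos m
      have hg1 : 1 ≤ g := Real.one_le_sqrt.2 (by nlinarith [sq_nonneg ‖m‖])
      have hg2 : g ^ 2 = 1 + ‖m‖ ^ 2 := Real.sq_sqrt (by positivity)
      have hv : ⟪W, velocity m⟫ = g⁻¹ * ⟪m, W⟫ := by
        rw [velocity, inner_smul_right, real_inner_comm]
      have hn : ‖m + s • W‖ ^ 2 = ‖m‖ ^ 2 + 2 * (s * ⟪m, W⟫) + s ^ 2 * ‖W‖ ^ 2 := by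
        rw [norm_add_sq_real, norm_smul, mul_pow, inner_smul_right]; simp
      rw [hn, hv]
      set X := s * ⟪m, W⟫
      set Y := s ^ 2 * ‖W‖ ^ 2 with hY
      have hY0 : 0 ≤ Y := by positivity
      have hpos : 0 ≤ 1 + (‖m‖ ^ 2 + 2 * X + Y) := by
        have := sq_nonneg ‖m + s • W‖
        rw [hn] at this; linarith
      have h3 : √(1 + (‖m‖ ^ 2 + 2 * X + Y)) ≤ g + (g⁻¹ * X + g⁻¹ * (Y / 2)) := by
        have h4 := Real.sq_sqrt hpos
        set r := √(1 + (‖m‖ ^ 2 + 2 * X + Y))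
        have h5 : g * r ≤ g * (g + (g⁻¹ * X + g⁻¹ * (Y / 2))) := by
          have : g * (g + (g⁻¹ * X + g⁻¹ * (Y / 2))) = g ^ 2 + X + Y / 2 := by
            field_simp; ring
          rw [this]
          nlinarith [sq_nonneg (r - g)]
        exact le_of_mul_le_mul_left h5 hgpos
      have h6 : g⁻¹ * (Y / 2) ≤ Y / 2 := by
        have : g⁻¹ ≤ 1 := inv_le_one_of_one_le₀ hg1
        nlinarith
      have h7 : s * (g⁻¹ * ⟪m, W⟫) = g⁻¹ * X := by ring
      rw [h7]; linarith
    have h3 : ∫ t in (0 : ℝ)..T, ⟪W, velocity (M t + l)⟫ = ‖W‖ ^ 2 := by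
      rw [← real_inner_self_eq_norm_sq]
      nth_rw 3 [hW]
      exact ((innerSL ℝ W).intervalIntegral_comp_comm (hvc.intervalIntegrable 0 T))
    rw [intervalIntegral.integral_add (Continuous.intervalIntegrable (by fun_prop) _ _)
      (Continuous.intervalIntegrable (by fun_prop) _ _),
      intervalIntegral.integral_add (Continuous.intervalIntegrable (by fun_prop) _ _)
      (Continuous.intervalIntegrable (by fun_prop) _ _), intervalIntegral.integral_const_mul, h3] at h2
    simp only [intervalIntegral.integral_const, smul_eq_mul, sub_zero] at h2
    have h4 : H l = ∫ t in (0 : ℝ)..T, √(1 + ‖M t + l‖ ^ 2) := rfl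
    linarith
  -- This `s` minimizes the quadratic bound, with value `-‖W‖² / (2T)`.
  have h := key (-T⁻¹)
  have h8 : (-T⁻¹) * ‖W‖ ^ 2 + (-T⁻¹) ^ 2 * ‖W‖ ^ 2 * T / 2 = -(T⁻¹ * ‖W‖ ^ 2 / 2) := by
    field_simp; ring
  rw [h8] at h
  have h9 : ‖W‖ ^ 2 ≤ 0 := by
    have : 0 < T⁻¹ := inv_pos.2 hT
    by_contra hc
    push Not at hc
    nlinarith [mul_pos this hc]
  exact norm_eq_zero.1 (by nlinarith [norm_nonneg W])

/-- A form of the Arzelà–Ascoli theorem. -/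
lemma exists_subseq_tendstoUniformlyOn {T : ℝ} (hT : 0 ≤ T) {f : ℕ → ℝ → Space} {K : ℝ≥0}
    {R : ℝ} (hL : ∀ n, LipschitzOnWith K (f n) (Icc 0 T))
    (hb : ∀ n, ∀ t ∈ Icc 0 T, ‖f n t‖ ≤ R) :
    ∃ (g : ℝ → Space) (φ : ℕ → ℕ), Continuous g ∧ StrictMono φ ∧
      TendstoUniformlyOn (fun n => f (φ n)) g atTop (Icc 0 T) := by
  let F : ℕ → BoundedContinuousFunction (Icc (0 : ℝ) T) Space := fun n =>
    BoundedContinuousFunction.mkOfCompact ⟨(Icc 0 T).domRestrict (f n), (hL n).continuousOn.domRestrict⟩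
  have hF : ∀ n x, F n x = f n x := fun n x => rfl
  have hcomp : IsCompact (closure (range F)) := by
    refine BoundedContinuousFunction.arzela_ascoli (Metric.closedBall 0 R)
      (isCompact_closedBall _ _) _ ?_ ?_
    · rintro _ x ⟨n, rfl⟩
      simpa [hF] using hb n x x.2
    · refine LipschitzWith.uniformEquicontinuous _ K ?_ |>.equicontinuous
      rintro ⟨_, n, rfl⟩
      exact fun x y => hL n x.2 y.2
  obtain ⟨G, -, φ, hφ, hG⟩ := hcomp.tendsto_subseq (fun n => subset_closure (mem_range_self n))
  refine ⟨fun t => G (projIcc 0 T hT t), φ, G.continuous.comp continuous_projIcc, hφ, ?_⟩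
  have h := BoundedContinuousFunction.tendsto_iff_tendstoUniformly.1 hG
  rw [Metric.tendstoUniformlyOn_iff]
  rw [Metric.tendstoUniformly_iff] at h
  intro ε hε
  filter_upwards [h ε hε] with n hn t ht
  have := hn ⟨t, ht⟩
  simpa [projIcc_of_mem hT ht, hF] using this

/-- At least one side of `c` in `[0, T]` has length `T / 2` or more, and that side alone supplies
the logarithm. The bound diverges as `η → 0`, uniformly in `c`. -/
lemma log_le_integral_inv_add_abs {T c η : ℝ} (hη : 0 < η) (hc : c ∈ Icc 0 T) :
    Real.log ((η + T / 2) / η) ≤ ∫ t in (0 : ℝ)..T, 1 / (η + |t - c|) := by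
  obtain ⟨hc0, hcT⟩ := hc
  have hcont : Continuous fun t : ℝ => 1 / (η + |t - c|) :=
    continuous_const.div (by fun_prop) fun t => by positivity
  have h1 : ∫ t in (0 : ℝ)..c, 1 / (η + |t - c|) = Real.log (η + c) - Real.log η := by
    rw [intervalIntegral.integral_eq_sub_of_hasDerivAt (f := fun t => -Real.log (η + (c - t)))
      _ (hcont.intervalIntegrable _ _)]
    · simp; ring
    · intro t ht
      rw [uIcc_of_le hc0] at ht
      have hpos : 0 < η + (c - t) := by linarith [ht.2]
      have h := ((((hasDerivAt_id t).const_sub c).const_add η).log hpos.ne').neg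
      rw [abs_of_nonpos (by linarith [ht.2]), neg_sub]
      exact h.congr_deriv (by simp [neg_div])
  have h2 : ∫ t in c..T, 1 / (η + |t - c|) = Real.log (η + (T - c)) - Real.log η := by
    rw [intervalIntegral.integral_eq_sub_of_hasDerivAt (f := fun t => Real.log (η + (t - c)))
      _ (hcont.intervalIntegrable _ _)]
    · simp
    · intro t ht
      rw [uIcc_of_le hcT] at ht
      have hpos : 0 < η + (t - c) := by linarith [ht.1]
      have h := (((hasDerivAt_id t).sub_const c).const_add η).log hpos.ne'
      rw [abs_of_nonneg (by linarith [ht.1])]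
      exact h
  rw [← intervalIntegral.integral_add_adjacent_intervals (hcont.intervalIntegrable 0 c)
    (hcont.intervalIntegrable c T), h1, h2, Real.log_div (by linarith) hη.ne']
  have h3 : Real.log η ≤ Real.log (η + c) := Real.log_le_log hη (by linarith)
  have h4 : Real.log η ≤ Real.log (η + (T - c)) := Real.log_le_log hη (by linarith)
  rcases le_total c (T / 2) with h | h
  · have : Real.log (η + T / 2) ≤ Real.log (η + (T - c)) :=
      Real.log_le_log (by linarith) (by linarith)
    linarith
  · have : Real.log (η + T / 2) ≤ Real.log (η + c) :=
      Real.log_le_log (by linarith) (by linarith)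
    linarith

/-! ### Regularity of the potentials and expansion of the interaction -/

section Fields

variable {T : ℝ} {S : Set Space} {A : ℝ → Space → Space} {Φ : ℝ → Space → ℝ}

lemma hasFDerivAt_slice (hA : ContDiff ℝ 1 fun p : ℝ × Space => A p.1 p.2) (t : ℝ) (x : Space) :
    HasFDerivAt (A t) ((fderiv ℝ (fun p : ℝ × Space => A p.1 p.2) (t, x)).comp
      (.inr ℝ ℝ Space)) x :=
  HasFDerivAt.comp x (hA.differentiable one_ne_zero (t, x)).hasFDerivAt
    (hasFDerivAt_prodMk_right t x)

lemma continuous_fderiv_slice (hA : ContDiff ℝ 1 fun p : ℝ × Space => A p.1 p.2) :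
    Continuous fun p : ℝ × Space => fderiv ℝ (A p.1) p.2 := by
  simp_rw [fun p : ℝ × Space => (hasFDerivAt_slice hA p.1 p.2).fderiv]
  exact (hA.continuous_fderiv one_ne_zero).clm_comp continuous_const

lemma hasDerivAt_along (hA : ContDiff ℝ 1 fun p : ℝ × Space => A p.1 p.2) {q : ℝ → Space}
    {u : Space} {t : ℝ} (hq : HasDerivAt q u t) :
    HasDerivAt (fun s => A s (q s)) (timeDeriv A t (q t) + fderiv ℝ (A t) (q t) u) t := by
  have h := (hA.differentiable one_ne_zero (t, q t)).hasFDerivAt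
  have h1 : HasDerivAt (fun s => A s (q s))
      (fderiv ℝ (fun p : ℝ × Space => A p.1 p.2) (t, q t) (1, u)) t :=
    HasFDerivAt.comp_hasDerivAt t (f := fun s => (s, q s)) h ((hasDerivAt_id t).prodMk hq)
  have h2 : HasDerivAt (fun s => A s (q t))
      (fderiv ℝ (fun p : ℝ × Space => A p.1 p.2) (t, q t) (1, 0)) t :=
    HasFDerivAt.comp_hasDerivAt t (f := fun s => (s, q t)) h
      ((hasDerivAt_id t).prodMk (hasDerivAt_const t (q t)))
  refine h1.congr_deriv ?_
  rw [timeDeriv, h2.deriv, (hasFDerivAt_slice hA t (q t)).fderiv, ContinuousLinearMap.comp_apply,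
    ← map_add]
  simp

lemma continuous_timeDeriv (hA : ContDiff ℝ 1 fun p : ℝ × Space => A p.1 p.2) :
    Continuous fun p : ℝ × Space => timeDeriv A p.1 p.2 := by
  have h : ∀ p : ℝ × Space, timeDeriv A p.1 p.2 =
      fderiv ℝ (fun p : ℝ × Space => A p.1 p.2) p (1, 0) := fun p =>
    (HasFDerivAt.comp_hasDerivAt p.1 (f := fun s => (s, p.2))
      (hA.differentiable one_ne_zero p).hasFDerivAt
      ((hasDerivAt_id p.1).prodMk (hasDerivAt_const p.1 p.2))).deriv
  simp_rw [h]
  exact (hA.continuous_fderiv one_ne_zero).clm_apply continuous_const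

lemma IsScalarPotential.hasGradientAt (hΦ : IsScalarPotential T S Φ) (hS : IsClosed S) (t : ℝ)
    {x : Space} (hx : x ∈ Sᶜ) : HasGradientAt (Φ t) (gradient (Φ t) x) x :=
  ((hΦ.contDiffOn t).contDiffAt (hS.isOpen_compl.mem_nhds hx)).differentiableAt one_ne_zero
    |>.hasGradientAt

lemma IsScalarPotential.abs_potential_sub_le (hΦ : IsScalarPotential T S Φ) (hS : IsClosed S) {t C : ℝ}
    {s : Set Space} (hs : Convex ℝ s) (hsS : s ⊆ Sᶜ) (hC : ∀ x ∈ s, ‖gradient (Φ t) x‖ ≤ C)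
    {x y : Space} (hx : x ∈ s) (hy : y ∈ s) : |Φ t y - Φ t x| ≤ C * ‖y - x‖ := by
  refine hs.norm_image_sub_le_of_norm_hasFDerivWithin_le (f := Φ t)
    (f' := fun z => InnerProductSpace.toDual ℝ Space (gradient (Φ t) z))
    (fun z hz => (hΦ.hasGradientAt hS t (hsS hz)).hasFDerivAt.hasFDerivWithinAt)
    (fun z hz => ?_) hx hy
  rw [LinearIsometryEquiv.norm_map]
  exact hC z hz

/-- Only separate continuity of `Φ` is assumed. Joint continuity follows because a local bound on
the gradient makes `Φ t` Lipschitz near a point with a constant independent of nearby `t`. -/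
lemma IsScalarPotential.continuousOn (hΦ : IsScalarPotential T S Φ) (hS : IsClosed S) :
    ContinuousOn (fun p : ℝ × Space => Φ p.1 p.2) (univ ×ˢ Sᶜ) := by
  rintro ⟨t₀, x₀⟩ ⟨-, hx₀⟩
  apply ContinuousAt.continuousWithinAt
  have hopen : IsOpen ((univ : Set ℝ) ×ˢ Sᶜ) := isOpen_univ.prod hS.isOpen_compl
  have hg := hΦ.continuousOn_gradient.continuousAt (hopen.mem_nhds ⟨mem_univ t₀, hx₀⟩)
  set C := ‖gradient (Φ t₀) x₀‖ + 1 with hC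
  have h1 : ∀ᶠ p : ℝ × Space in 𝓝 (t₀, x₀), ‖gradient (Φ p.1) p.2‖ < C :=
    hg.norm.eventually_lt_const (by simp [hC])
  have h2 : ∀ᶠ p : ℝ × Space in 𝓝 (t₀, x₀), p ∈ (univ : Set ℝ) ×ˢ Sᶜ :=
    hopen.mem_nhds ⟨mem_univ t₀, hx₀⟩
  obtain ⟨δ, hδ, hball⟩ := Metric.eventually_nhds_iff.1 (h1.and h2)
  have hb : ∀ t, |t - t₀| < δ → ∀ x ∈ Metric.ball x₀ δ, ‖gradient (Φ t) x‖ ≤ C ∧ x ∈ Sᶜ := by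
    intro t ht x hx
    have := @hball (t, x) (by rw [Prod.dist_eq]; exact max_lt ht hx)
    exact ⟨this.1.le, this.2.2⟩
  have hle : ∀ᶠ p : ℝ × Space in 𝓝 (t₀, x₀),
      ‖Φ p.1 p.2 - Φ t₀ x₀‖ ≤ C * ‖p.2 - x₀‖ + |Φ p.1 x₀ - Φ t₀ x₀| := by
    filter_upwards [Metric.ball_mem_nhds (t₀, x₀) hδ] with p hp
    rw [Metric.mem_ball, Prod.dist_eq, max_lt_iff] at hp
    have := hΦ.abs_potential_sub_le hS (convex_ball x₀ δ) (fun x hx => (hb p.1 hp.1 x hx).2)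
      (fun x hx => (hb p.1 hp.1 x hx).1) (Metric.mem_ball_self hδ) (y := p.2) hp.2
    rw [Real.norm_eq_abs]
    linarith [abs_sub_le (Φ p.1 p.2) (Φ p.1 x₀) (Φ t₀ x₀)]
  rw [ContinuousAt, tendsto_iff_norm_sub_tendsto_zero]
  refine squeeze_zero' (Eventually.of_forall fun _ => norm_nonneg _) hle ?_
  have h3 : Continuous fun p : ℝ × Space => C * ‖p.2 - x₀‖ + |Φ p.1 x₀ - Φ t₀ x₀| := by
    have := (hΦ.continuous_time x₀ hx₀).comp (continuous_fst (X := ℝ) (Y := Space))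
    exact (by fun_prop : Continuous fun p : ℝ × Space => C * ‖p.2 - x₀‖).add
      (this.sub continuous_const).abs
  simpa using h3.tendsto (t₀, x₀)

/-- The velocity-dependent part of the Lagrangian of the Lorentz force equation. -/
def interaction (A : ℝ → Space → Space) (Φ : ℝ → Space → ℝ) (t : ℝ) (x a : Space) : ℝ :=
  ⟪a, A t x⟫ - Φ t x

/-- The derivative of `interaction` at `(x, a)` in the direction `(y, b)`. -/
def interactionVar (A : ℝ → Space → Space) (Φ : ℝ → Space → ℝ) (t : ℝ) (x a y b : Space) : ℝ :=
  ⟪b, A t x⟫ + ⟪a, fderiv ℝ (A t) x y⟫ - ⟪gradient (Φ t) x, y⟫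

lemma hasDerivAt_interaction (hA : ContDiff ℝ 1 fun p : ℝ × Space => A p.1 p.2)
    (hΦ : IsScalarPotential T S Φ) (hS : IsClosed S) (t σ : ℝ) (x a y b : Space)
    (hx : x + σ • y ∈ Sᶜ) :
    HasDerivAt (fun s => interaction A Φ t (x + s • y) (a + s • b))
      (interactionVar A Φ t (x + σ • y) (a + σ • b) y b) σ := by
  have hx' : HasDerivAt (fun s : ℝ => x + s • y) y σ := by
    simpa using ((hasDerivAt_id σ).smul_const y).const_add x
  have ha' : HasDerivAt (fun s : ℝ => a + s • b) b σ := by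
    simpa using ((hasDerivAt_id σ).smul_const b).const_add a
  have hA' : HasDerivAt (fun s => A t (x + s • y)) (fderiv ℝ (A t) (x + σ • y) y) σ :=
    ((hasFDerivAt_slice hA t (x + σ • y)).differentiableAt.hasFDerivAt).comp_hasDerivAt σ hx'
  have hΦ' : HasDerivAt (fun s => Φ t (x + s • y)) ⟪gradient (Φ t) (x + σ • y), y⟫ σ := by
    have := (hΦ.hasGradientAt hS t hx).hasFDerivAt.comp_hasDerivAt_of_eq σ hx' rfl
    exact this.congr_deriv (InnerProductSpace.toDual_apply_apply ..)
  refine ((ha'.inner ℝ hA').sub hΦ').congr_deriv ?_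
  simp only [interactionVar]; ring

lemma continuousOn_interaction (hA : ContDiff ℝ 1 fun p : ℝ × Space => A p.1 p.2)
    (hΦ : IsScalarPotential T S Φ) (hS : IsClosed S) :
    ContinuousOn (fun p : ℝ × Space × Space => interaction A Φ p.1 p.2.1 p.2.2)
      (univ ×ˢ Sᶜ ×ˢ univ) := by
  have h1 : Continuous fun p : ℝ × Space × Space => A p.1 p.2.1 :=
    hA.continuous.comp (by fun_prop : Continuous fun p : ℝ × Space × Space => (p.1, p.2.1))
  have h2 : ContinuousOn (fun p : ℝ × Space × Space => Φ p.1 p.2.1) (univ ×ˢ Sᶜ ×ˢ univ) :=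
    (hΦ.continuousOn hS).comp
      (by fun_prop : Continuous fun p : ℝ × Space × Space => (p.1, p.2.1)).continuousOn
      fun p hp => ⟨mem_univ _, hp.2.1⟩
  unfold interaction
  exact (by fun_prop : Continuous fun p : ℝ × Space × Space => ⟪p.2.2, A p.1 p.2.1⟫).continuousOn.sub h2

lemma continuousOn_interactionVar (hA : ContDiff ℝ 1 fun p : ℝ × Space => A p.1 p.2)
    (hΦ : IsScalarPotential T S Φ) :
    ContinuousOn (fun p : ℝ × Space × Space × Space × Space =>
      interactionVar A Φ p.1 p.2.1 p.2.2.1 p.2.2.2.1 p.2.2.2.2) (univ ×ˢ Sᶜ ×ˢ univ) := by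
  have h0 : Continuous fun p : ℝ × Space × Space × Space × Space => (p.1, p.2.1) := by fun_prop
  have h1 : Continuous fun p : ℝ × Space × Space × Space × Space => A p.1 p.2.1 :=
    hA.continuous.comp h0
  have h2 : ContinuousOn (fun p : ℝ × Space × Space × Space × Space => gradient (Φ p.1) p.2.1)
      (univ ×ˢ Sᶜ ×ˢ univ) :=
    hΦ.continuousOn_gradient.comp h0.continuousOn fun p hp => ⟨mem_univ _, hp.2.1⟩
  have h3 : Continuous fun p : ℝ × Space × Space × Space × Space =>
      fderiv ℝ (A p.1) p.2.1 p.2.2.2.1 :=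
    ((continuous_fderiv_slice hA).comp h0).clm_apply (by fun_prop)
  unfold interactionVar
  exact (by fun_prop : Continuous fun p : ℝ × Space × Space × Space × Space =>
    ⟪p.2.2.2.2, A p.1 p.2.1⟫ + ⟪p.2.2.1, fderiv ℝ (A p.1) p.2.1 p.2.2.2.1⟫).continuousOn.sub
    (h2.inner (by fun_prop))

/-- First-order expansion of the interaction, uniform over compact sets of positions. -/
lemma exists_interaction_le (hA : ContDiff ℝ 1 fun p : ℝ × Space => A p.1 p.2)
    (hΦ : IsScalarPotential T S Φ) (hS : IsClosed S) {C : Set Space} (hC : IsCompact C)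
    (hCS : C ⊆ Sᶜ) {V ε : ℝ} (hV : 0 ≤ V) (hε : 0 < ε) :
    ∃ s > 0, s ≤ 1 ∧ ∀ t ∈ Icc 0 T, ∀ x ∈ C, ∀ a y b : Space, ‖a‖ ≤ 1 → ‖y‖ ≤ V → ‖b‖ ≤ 2 →
      x + s • y ∈ Sᶜ ∧ interaction A Φ t (x + s • y) (a + s • b) ≤
        interaction A Φ t x a + s * (interactionVar A Φ t x a y b + ε) := by
  obtain ⟨δ, hδ, hCδ⟩ := hC.exists_cthickening_subset_open hS.isOpen_compl hCS
  set K : Set (ℝ × Space × Space × Space × Space) := Icc 0 T ×ˢ Metric.cthickening δ C ×ˢ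
    Metric.closedBall 0 3 ×ˢ Metric.closedBall 0 V ×ˢ Metric.closedBall 0 2 with hK
  have hKc : IsCompact K := isCompact_Icc.prod (hC.cthickening.prod ((isCompact_closedBall _ _).prod
    ((isCompact_closedBall _ _).prod (isCompact_closedBall _ _))))
  have huc := hKc.uniformContinuousOn_of_continuous
    ((continuousOn_interactionVar hA hΦ).mono fun p hp => ⟨mem_univ _, hCδ hp.2.1, mem_univ _⟩)
  obtain ⟨η, hη, hηK⟩ := Metric.uniformContinuousOn_iff.1 huc ε hε
  -- The second bound keeps the segment inside the thickening of `C`; the third keeps it within the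
  -- modulus of continuity `η`. Adding `1` and `3` to `V` avoids division by zero and gives the
  -- strict inequality.
  set s := min 1 (min (δ / (V + 1)) (η / (2 * (V + 3)))) with hs
  have hs0 : 0 < s := by positivity
  have hs1 : s ≤ 1 := min_le_left _ _
  have hsδ : s * V ≤ δ := by
    have : s ≤ δ / (V + 1) := (min_le_right _ _).trans (min_le_left _ _)
    rw [le_div_iff₀ (by positivity)] at this
    nlinarith
  have hsη : s * (V + 2) < η := by
    have : s ≤ η / (2 * (V + 3)) := (min_le_right _ _).trans (min_le_right _ _)
    rw [le_div_iff₀ (by positivity)] at this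
    nlinarith
  refine ⟨s, hs0, hs1, fun t ht x hx a y b ha hy hb => ?_⟩
  have hmem : ∀ σ ∈ Icc 0 s, x + σ • y ∈ Metric.cthickening δ C := by
    intro σ hσ
    refine Metric.mem_cthickening_of_dist_le _ x δ C hx ?_
    rw [dist_self_add_left, norm_smul, Real.norm_of_nonneg hσ.1]
    exact (mul_le_mul hσ.2 hy (norm_nonneg _) hs0.le).trans hsδ
  refine ⟨hCδ (hmem s ⟨hs0.le, le_rfl⟩), ?_⟩
  have hder : ∀ σ ∈ Icc 0 s, HasDerivAt (fun s => interaction A Φ t (x + s • y) (a + s • b))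
      (interactionVar A Φ t (x + σ • y) (a + σ • b) y b) σ := fun σ hσ =>
    hasDerivAt_interaction hA hΦ hS t σ x a y b (hCδ (hmem σ hσ))
  -- The mean value theorem turns the increment into the variation at an intermediate point, which
  -- uniform continuity compares with the variation at the start.
  obtain ⟨σ, hσ, hslope⟩ := exists_hasDerivAt_eq_slope _ _ hs0
    (fun σ hσ => (hder σ hσ).continuousAt.continuousWithinAt)
    (fun σ hσ => hder σ (Ioo_subset_Icc_self hσ))
  have hσ' := Ioo_subset_Icc_self hσ
  have hb' : ‖σ • b‖ ≤ s * 2 := by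
    rw [norm_smul, Real.norm_of_nonneg hσ'.1]
    exact mul_le_mul hσ'.2 hb (norm_nonneg _) hs0.le
  have hy' : ‖σ • y‖ ≤ s * V := by
    rw [norm_smul, Real.norm_of_nonneg hσ'.1]
    exact mul_le_mul hσ'.2 hy (norm_nonneg _) hs0.le
  have hclose := hηK (t, x + σ • y, a + σ • b, y, b)
    ⟨ht, hmem σ hσ', by
      rw [mem_closedBall_zero_iff]; exact (norm_add_le _ _).trans (by linarith),
      by simpa using hy, by simpa using hb⟩
    (t, x, a, y, b)
    ⟨ht, Metric.self_subset_cthickening C hx, by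
      rw [mem_closedBall_zero_iff]; linarith, by simpa using hy, by simpa using hb⟩
    (by
      simp only [Prod.dist_eq, dist_self, dist_self_add_left, max_lt_iff]
      refine ⟨hη, ?_, ?_, hη⟩ <;> nlinarith)
  rw [Real.dist_eq] at hclose
  have h4 := (abs_lt.1 hclose).2
  rw [hslope, zero_smul, zero_smul, add_zero, add_zero, sub_zero] at h4
  have h5 : (interaction A Φ t (x + s • y) (a + s • b) - interaction A Φ t x a) / s <
    interactionVar A Φ t x a y b + ε := by
    dsimp only at h4
    linarith
  rw [div_lt_iff₀ hs0] at h5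
  linarith

end Fields

/-! ### The action, its approximate variational inequality, and the impulse -/

section Loops

variable {T : ℝ} {S : Set Space} {A : ℝ → Space → Space} {Φ : ℝ → Space → ℝ}

/-- Closed `C¹` curves on `[0, T]` in the complement of `S`, of speed at most one, together with
their velocity. -/
structure IsLoop (T : ℝ) (S : Set Space) (q u : ℝ → Space) : Prop where
  hasDerivAt : ∀ t, HasDerivAt q (u t) t
  continuous_velocity : Continuous u
  speed : ∀ t ∈ Icc 0 T, ‖u t‖ ≤ 1
  mem : ∀ t ∈ Icc 0 T, q t ∈ Sᶜ
  closed : q T = q 0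

/-- The action functional of the Lorentz force equation. -/
def action (T : ℝ) (A : ℝ → Space → Space) (Φ : ℝ → Space → ℝ) (q u : ℝ → Space) : ℝ :=
  ∫ t in (0 : ℝ)..T, (kinetic (u t) + interaction A Φ t (q t) (u t))

lemma continuous_of_hasDerivAt {q u : ℝ → Space} (h : ∀ t, HasDerivAt q (u t) t) : Continuous q :=
  continuous_iff_continuousAt.2 fun t => (h t).continuousAt

lemma IsLoop.continuous {q u : ℝ → Space} (h : IsLoop T S q u) : Continuous q :=
  continuous_of_hasDerivAt h.hasDerivAt

lemma IsLoop.norm_sub_le {q u : ℝ → Space} (h : IsLoop T S q u) {s t : ℝ} (hs : s ∈ Icc 0 T)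
    (ht : t ∈ Icc 0 T) : ‖q t - q s‖ ≤ |t - s| := by
  have := (convex_Icc (0 : ℝ) T).norm_image_sub_le_of_norm_hasDerivWithin_le
    (fun r _ => (h.hasDerivAt r).hasDerivWithinAt) h.speed hs ht
  simpa using this

lemma IsLoop.intervalIntegrable_interaction {q u : ℝ → Space} (h : IsLoop T S q u) (hT : 0 ≤ T)
    (hA : ContDiff ℝ 1 fun p : ℝ × Space => A p.1 p.2)
    (hΦ : IsScalarPotential T S Φ) (hS : IsClosed S) :
    IntervalIntegrable (fun t => interaction A Φ t (q t) (u t)) volume 0 T := by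
  apply ContinuousOn.intervalIntegrable
  rw [uIcc_of_le hT]
  have := h.continuous
  have := h.continuous_velocity
  have hmaps : MapsTo (fun t => (t, q t, u t)) (Icc 0 T) (univ ×ˢ Sᶜ ×ˢ univ) :=
    fun t ht => ⟨mem_univ t, h.mem t ht, mem_univ (u t)⟩
  exact ContinuousOn.comp (f := fun t => (t, q t, u t)) (continuousOn_interaction hA hΦ hS)
    (by fun_prop : Continuous fun t => (t, q t, u t)).continuousOn hmaps

lemma IsLoop.intervalIntegrable_interactionVar {q u v v' : ℝ → Space} (h : IsLoop T S q u)
    (hT : 0 ≤ T) (hA : ContDiff ℝ 1 fun p : ℝ × Space => A p.1 p.2)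
    (hΦ : IsScalarPotential T S Φ) (hv : Continuous v) (hv' : Continuous v') :
    IntervalIntegrable (fun t => interactionVar A Φ t (q t) (u t) (v t) (v' t)) volume 0 T := by
  apply ContinuousOn.intervalIntegrable
  rw [uIcc_of_le hT]
  have := h.continuous
  have := h.continuous_velocity
  have hmaps : MapsTo (fun t => (t, q t, u t, v t, v' t)) (Icc 0 T) (univ ×ˢ Sᶜ ×ˢ univ) :=
    fun t ht => ⟨mem_univ t, h.mem t ht, mem_univ (u t, v t, v' t)⟩
  exact ContinuousOn.comp (f := fun t => (t, q t, u t, v t, v' t)) (continuousOn_interactionVar hA hΦ)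
    (by fun_prop : Continuous fun t => (t, q t, u t, v t, v' t)).continuousOn hmaps

/-- The approximate variational inequality satisfied by almost minimizers of the action. -/
lemma exists_integral_kinetic_le (hT : 0 < T)
    (hA : ContDiff ℝ 1 fun p : ℝ × Space => A p.1 p.2)
    (hΦ : IsScalarPotential T S Φ) (hS : IsClosed S) {C : Set Space} (hC : IsCompact C)
    (hCS : C ⊆ Sᶜ) {V ε m : ℝ} (hV : 0 ≤ V) (hε : 0 < ε)
    (hm : ∀ q u, IsLoop T S q u → m ≤ action T A Φ q u) :
    ∃ δ > 0, ∀ q u v v' : ℝ → Space, IsLoop T S q u → (∀ t ∈ Icc 0 T, q t ∈ C) →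
      action T A Φ q u ≤ m + δ → (∀ t, HasDerivAt v (v' t) t) → Continuous v' → v T = v 0 →
      (∀ t ∈ Icc 0 T, ‖v t‖ ≤ V) → (∀ t ∈ Icc 0 T, ‖u t + v' t‖ ≤ 1) →
      ∫ t in (0 : ℝ)..T, kinetic (u t) ≤ (∫ t in (0 : ℝ)..T, kinetic (u t + v' t)) +
        (∫ t in (0 : ℝ)..T, interactionVar A Φ t (q t) (u t) (v t) (v' t)) + ε := by
  obtain ⟨s, hs0, hs1, hs⟩ := exists_interaction_le (T := T) hA hΦ hS hC hCS hV
    (show 0 < ε / (2 * T) by positivity)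
  -- The step `s` depends on `C`, `V` and `ε` but not on the loop. The action defect is eventually
  -- divided by `s`, so a defect of `s * (ε / 2)` costs `ε / 2`; the other half is the expansion
  -- error.
  refine ⟨s * (ε / 2), by positivity, fun q u v v' hq hqC hact hv hv' hvT hvV huv => ?_⟩
  have hvc := continuous_of_hasDerivAt hv
  have huc := hq.continuous_velocity
  have hqc := hq.continuous
  have hv2 : ∀ t ∈ Icc 0 T, ‖v' t‖ ≤ 2 := fun t ht => by
    have := norm_sub_le (u t + v' t) (u t)
    rw [add_sub_cancel_left] at this
    linarith [hq.speed t ht, huv t ht]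
  -- The competitor has velocity `(1 - s) u + s (u + v')`, so the speed constraint survives by
  -- convexity.
  have hloop : IsLoop T S (fun t => q t + s • v t) (fun t => u t + s • v' t) := by
    refine ⟨fun t => (hq.hasDerivAt t).add ((hv t).const_smul s), by fun_prop, fun t ht => ?_,
      fun t ht => (hs t ht _ (hqC t ht) (u t) (v t) (v' t) (hq.speed t ht) (hvV t ht)
        (hv2 t ht)).1, by simp [hq.closed, hvT]⟩
    have e : u t + s • v' t = (1 - s) • u t + s • (u t + v' t) := by module
    rw [e]
    refine (norm_add_le _ _).trans ?_
    rw [norm_smul, norm_smul, Real.norm_of_nonneg hs0.le, Real.norm_of_nonneg (by linarith)]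
    nlinarith [hq.speed t ht, huv t ht]
  have hkc := continuous_kinetic
  have i1 : IntervalIntegrable (fun t => kinetic (u t)) volume 0 T :=
    (hkc.comp huc).intervalIntegrable _ _
  have i2 : IntervalIntegrable (fun t => kinetic (u t + v' t)) volume 0 T :=
    (hkc.comp (huc.add hv')).intervalIntegrable _ _
  have i2' : IntervalIntegrable (fun t => kinetic (u t + s • v' t)) volume 0 T :=
    (hkc.comp (by fun_prop)).intervalIntegrable _ _
  have i3 := hq.intervalIntegrable_interaction hT.le hA hΦ hS
  have i4 := hloop.intervalIntegrable_interaction hT.le hA hΦ hS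
  have i5 := hq.intervalIntegrable_interactionVar hT.le hA hΦ hvc hv'
  have hle : action T A Φ (fun t => q t + s • v t) (fun t => u t + s • v' t) ≤
      ∫ t in (0 : ℝ)..T, ((kinetic (u t) + interaction A Φ t (q t) (u t)) +
        s * ((kinetic (u t + v' t) - kinetic (u t)) +
          (interactionVar A Φ t (q t) (u t) (v t) (v' t) + ε / (2 * T)))) := by
    refine intervalIntegral.integral_mono_on hT.le (i2'.add i4)
      ((i1.add i3).add (((i2.sub i1).add (i5.add (by simp))).const_mul s)) fun t ht => ?_
    have h1 := (hs t ht _ (hqC t ht) (u t) (v t) (v' t) (hq.speed t ht) (hvV t ht) (hv2 t ht)).2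
    have h2 := kinetic_convex (hq.speed t ht) (huv t ht) hs0.le hs1
    rw [add_sub_cancel_left] at h2
    linarith
  rw [intervalIntegral.integral_add (i1.add i3) (((i2.sub i1).add (i5.add (by simp))).const_mul s),
    intervalIntegral.integral_const_mul, intervalIntegral.integral_add (i2.sub i1)
    (i5.add (by simp)), intervalIntegral.integral_sub i2 i1,
    intervalIntegral.integral_add i5 (by simp), intervalIntegral.integral_const] at hle
  have hmin := hm _ _ hloop
  have e : (T - 0) • (ε / (2 * T)) = ε / 2 := by rw [smul_eq_mul]; field_simp; ring
  rw [e] at hle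
  unfold action at hact hmin hle
  have h6 : 0 ≤ s * ((∫ t in (0 : ℝ)..T, kinetic (u t + v' t)) -
      (∫ t in (0 : ℝ)..T, kinetic (u t)) +
      ((∫ t in (0 : ℝ)..T, interactionVar A Φ t (q t) (u t) (v t) (v' t)) + ε / 2) + ε / 2) := by
    rw [mul_add]; linarith
  have h7 := nonneg_of_mul_nonneg_right h6 hs0
  linarith

/-- The part `(DA)ᵀ u - ∇Φ` of the force. -/
def force (A : ℝ → Space → Space) (Φ : ℝ → Space → ℝ) (t : ℝ) (x a : Space) : Space :=
  ContinuousLinearMap.adjoint (fderiv ℝ (A t) x) a - gradient (Φ t) x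

lemma interactionVar_eq (t : ℝ) (x a y b : Space) :
    interactionVar A Φ t x a y b = ⟪b, A t x⟫ + ⟪force A Φ t x a, y⟫ := by
  rw [interactionVar, force, inner_sub_left, ContinuousLinearMap.adjoint_inner_left]
  ring

lemma continuousOn_force (hA : ContDiff ℝ 1 fun p : ℝ × Space => A p.1 p.2)
    (hΦ : IsScalarPotential T S Φ) :
    ContinuousOn (fun p : ℝ × Space × Space => force A Φ p.1 p.2.1 p.2.2)
      (univ ×ˢ Sᶜ ×ˢ univ) := by
  have h0 : Continuous fun p : ℝ × Space × Space => (p.1, p.2.1) := by fun_prop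
  have h1 : Continuous fun p : ℝ × Space × Space =>
      ContinuousLinearMap.adjoint (fderiv ℝ (A p.1) p.2.1) p.2.2 :=
    ((LinearIsometryEquiv.continuous _).comp ((continuous_fderiv_slice hA).comp h0)).clm_apply
      (by fun_prop)
  exact h1.continuousOn.sub
    (hΦ.continuousOn_gradient.comp h0.continuousOn fun p hp => ⟨mem_univ _, hp.2.1⟩)

/-- The projection of the real line onto `[0, T]`. -/
def clamp (T t : ℝ) : ℝ := max 0 (min T t)

lemma clamp_mem (hT : 0 ≤ T) (t : ℝ) : clamp T t ∈ Icc 0 T :=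
  ⟨le_max_left _ _, max_le hT (min_le_left _ _)⟩

lemma clamp_of_mem {t : ℝ} (ht : t ∈ Icc 0 T) : clamp T t = t := by
  simp [clamp, ht.1, ht.2]

lemma continuous_clamp : Continuous (clamp T) := by unfold clamp; fun_prop

/-- The time integral of `force` along a curve. -/
def impulse (T : ℝ) (A : ℝ → Space → Space) (Φ : ℝ → Space → ℝ) (q u : ℝ → Space) (t : ℝ) :
    Space :=
  ∫ s in (0 : ℝ)..t, force A Φ (clamp T s) (q (clamp T s)) (u (clamp T s))

/-- A loop is only known to avoid `S` for times in `[0, T]`. Clamping the time makes the integrand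
continuous on the whole line, so the impulse is differentiable everywhere. -/
lemma continuous_force_clamp (hT : 0 ≤ T) (hA : ContDiff ℝ 1 fun p : ℝ × Space => A p.1 p.2)
    (hΦ : IsScalarPotential T S Φ) {q u : ℝ → Space} (hq : Continuous q) (hu : Continuous u)
    (hmem : ∀ t ∈ Icc 0 T, q t ∈ Sᶜ) :
    Continuous fun s => force A Φ (clamp T s) (q (clamp T s)) (u (clamp T s)) := by
  have hc := continuous_clamp (T := T)
  have hmaps : ∀ t, (clamp T t, q (clamp T t), u (clamp T t)) ∈ (univ ×ˢ Sᶜ ×ˢ univ) :=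
    fun t => ⟨mem_univ (clamp T t), hmem _ (clamp_mem hT t), mem_univ (u (clamp T t))⟩
  exact ContinuousOn.comp_continuous (f := fun t => (clamp T t, q (clamp T t), u (clamp T t)))
    (continuousOn_force hA hΦ) (by fun_prop) hmaps

lemma hasDerivAt_impulse (hT : 0 ≤ T) (hA : ContDiff ℝ 1 fun p : ℝ × Space => A p.1 p.2)
    (hΦ : IsScalarPotential T S Φ) {q u : ℝ → Space} (hq : Continuous q) (hu : Continuous u)
    (hmem : ∀ t ∈ Icc 0 T, q t ∈ Sᶜ) (t : ℝ) :
    HasDerivAt (impulse T A Φ q u)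
      (force A Φ (clamp T t) (q (clamp T t)) (u (clamp T t))) t :=
  (continuous_force_clamp hT hA hΦ hq hu hmem).integral_hasStrictDerivAt 0 t |>.hasDerivAt

lemma impulse_zero (q u : ℝ → Space) : impulse T A Φ q u 0 = 0 := by simp [impulse]

lemma exists_norm_force_le (hA : ContDiff ℝ 1 fun p : ℝ × Space => A p.1 p.2)
    (hΦ : IsScalarPotential T S Φ) {C : Set Space} (hC : IsCompact C) (hCS : C ⊆ Sᶜ) :
    ∃ K : ℝ≥0, ∀ t ∈ Icc 0 T, ∀ x ∈ C, ∀ a : Space, ‖a‖ ≤ 1 → ‖force A Φ t x a‖ ≤ K := by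
  obtain ⟨K, hK⟩ := (isCompact_Icc.prod (hC.prod (isCompact_closedBall (0 : Space) 1)))
    |>.exists_bound_of_continuousOn (s := Icc 0 T ×ˢ C ×ˢ Metric.closedBall (0 : Space) 1)
    ((continuousOn_force hA hΦ).mono fun p hp => ⟨mem_univ _, hCS hp.2.1, mem_univ _⟩)
  exact ⟨K.toNNReal, fun t ht x hx a ha =>
    (hK (t, x, a) ⟨ht, hx, by simpa using ha⟩).trans (Real.le_coe_toNNReal K)⟩

/-- Integration by parts moves the force onto `v'`. Apart from the boundary term, the variation then
pairs `v'` with a function of time that has a uniform limit along subsequences of minimizing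
sequences. -/
lemma integral_interactionVar (hT : 0 ≤ T) (hA : ContDiff ℝ 1 fun p : ℝ × Space => A p.1 p.2)
    (hΦ : IsScalarPotential T S Φ) {q u v v' : ℝ → Space} (hq : IsLoop T S q u)
    (hv : ∀ t, HasDerivAt v (v' t) t) (hv' : Continuous v') :
    ∫ t in (0 : ℝ)..T, interactionVar A Φ t (q t) (u t) (v t) (v' t) =
      (∫ t in (0 : ℝ)..T, ⟪v' t, A t (q t) - impulse T A Φ q u t⟫) +
        ⟪impulse T A Φ q u T, v T⟫ := by
  have hvc := continuous_of_hasDerivAt hv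
  have hqc := hq.continuous
  have huc := hq.continuous_velocity
  have hG := hasDerivAt_impulse hT hA hΦ hqc huc hq.mem
  have hGc := continuous_of_hasDerivAt hG
  have hfc := continuous_force_clamp hT hA hΦ hqc huc hq.mem
  have hAc : Continuous fun t => A t (q t) :=
    hA.continuous.comp (by fun_prop : Continuous fun t => (t, q t))
  have hd : ∀ t, HasDerivAt (fun t => ⟪impulse T A Φ q u t, v t⟫)
      (⟪impulse T A Φ q u t, v' t⟫ +
        ⟪force A Φ (clamp T t) (q (clamp T t)) (u (clamp T t)), v t⟫) t :=
    fun t => (hG t).inner ℝ (hv t)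
  have h1 := intervalIntegral.integral_eq_sub_of_hasDerivAt (fun t _ => hd t)
    (Continuous.intervalIntegrable (by fun_prop) 0 T)
  rw [impulse_zero, inner_zero_left, sub_zero] at h1
  rw [← h1, ← intervalIntegral.integral_add (Continuous.intervalIntegrable (by fun_prop) _ _)
    (Continuous.intervalIntegrable (by fun_prop) _ _)]
  refine intervalIntegral.integral_congr fun t ht => ?_
  rw [uIcc_of_le hT] at ht
  simp only [interactionVar_eq, clamp_of_mem ht, inner_sub_right,
    real_inner_comm (v' t) (impulse T A Φ q u t)]
  ring

end Loops

/-! ### Strong convergence of the velocities along minimizing sequences -/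

section Convergence

variable {T : ℝ} {S : Set Space} {A : ℝ → Space → Space} {Φ : ℝ → Space → ℝ}

lemma integral_norm_le_add {f : ℝ → Space} (hT : 0 ≤ T) (hf : Continuous f) {η : ℝ} (hη : 0 < η) :
    ∫ t in (0 : ℝ)..T, ‖f t‖ ≤ η * T / 2 + (∫ t in (0 : ℝ)..T, ‖f t‖ ^ 2) / (2 * η) := by
  have h : ∫ t in (0 : ℝ)..T, ‖f t‖ ≤ ∫ t in (0 : ℝ)..T, (η / 2 + ‖f t‖ ^ 2 / (2 * η)) := by
    refine intervalIntegral.integral_mono_on hT (Continuous.intervalIntegrable (by fun_prop) _ _)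
      (Continuous.intervalIntegrable (by fun_prop) _ _) fun t _ => ?_
    have : η / 2 + ‖f t‖ ^ 2 / (2 * η) - ‖f t‖ = (η - ‖f t‖) ^ 2 / (2 * η) := by
      field_simp; ring
    have h2 : 0 ≤ (η - ‖f t‖) ^ 2 / (2 * η) := by positivity
    linarith
  rw [intervalIntegral.integral_add (Continuous.intervalIntegrable (by fun_prop) _ _)
    (Continuous.intervalIntegrable (by fun_prop) _ _), intervalIntegral.integral_const, sub_zero, smul_eq_mul,
    intervalIntegral.integral_div (2 * η) fun t => ‖f t‖ ^ 2] at h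
  linarith

lemma tendsto_integral_norm_of_sq {f : ℕ → ℝ → Space} (hT : 0 < T) (hf : ∀ n, Continuous (f n))
    (h : Tendsto (fun n => ∫ t in (0 : ℝ)..T, ‖f n t‖ ^ 2) atTop (𝓝 0)) :
    Tendsto (fun n => ∫ t in (0 : ℝ)..T, ‖f n t‖) atTop (𝓝 0) := by
  rw [Metric.tendsto_nhds]
  intro ε hε
  have hη : 0 < ε / T := by positivity
  have h1 : ∀ᶠ n in atTop, ∫ t in (0 : ℝ)..T, ‖f n t‖ ^ 2 < ε * (ε / T) / 2 :=
    h.eventually_lt_const (by positivity)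
  filter_upwards [h1] with n hn
  have h2 := integral_norm_le_add hT.le (hf n) hη
  have h3 : 0 ≤ ∫ t in (0 : ℝ)..T, ‖f n t‖ :=
    intervalIntegral.integral_nonneg hT.le fun _ _ => norm_nonneg _
  rw [Real.dist_0_eq_abs, abs_of_nonneg h3]
  have h4 : (∫ t in (0 : ℝ)..T, ‖f n t‖ ^ 2) / (2 * (ε / T)) < ε / 4 := by
    rw [div_lt_iff₀ (by positivity)]
    linarith
  have h5 : ε / T * T / 2 = ε / 2 := by field_simp
  linarith

lemma norm_integral_le_integral_norm_of_mem {f : ℝ → Space} (hf : Continuous f) {t : ℝ}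
    (ht : t ∈ Icc 0 T) : ‖∫ s in (0 : ℝ)..t, f s‖ ≤ ∫ s in (0 : ℝ)..T, ‖f s‖ :=
  (intervalIntegral.norm_integral_le_integral_norm ht.1).trans
    (intervalIntegral.integral_mono_interval le_rfl ht.1 ht.2
      (Eventually.of_forall fun _ => norm_nonneg _) (hf.norm.intervalIntegrable _ _))

lemma tendstoUniformlyOn_comp_of_isCompact {F : Type*} [PseudoMetricSpace F]
    {G : ℝ × Space × Space → F} {C : Set Space}
    (hC : IsCompact C) (hG : ContinuousOn G (Icc 0 T ×ˢ C ×ˢ Metric.closedBall 0 1))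
    {q : ℕ → ℝ → Space} {q₀ u : ℝ → Space} (hq : ∀ n, ∀ t ∈ Icc 0 T, q n t ∈ C)
    (hq₀ : ∀ t ∈ Icc 0 T, q₀ t ∈ C) (hu : ∀ t, ‖u t‖ ≤ 1)
    (hlim : TendstoUniformlyOn q q₀ atTop (Icc 0 T)) :
    TendstoUniformlyOn (fun n t => G (t, q n t, u t)) (fun t => G (t, q₀ t, u t)) atTop
      (Icc 0 T) := by
  have huc := (isCompact_Icc.prod (hC.prod (isCompact_closedBall (0 : Space) 1)))
    |>.uniformContinuousOn_of_continuous hG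
  rw [Metric.uniformContinuousOn_iff] at huc
  rw [Metric.tendstoUniformlyOn_iff] at hlim ⊢
  intro ε hε
  obtain ⟨δ, hδ, h⟩ := huc ε hε
  filter_upwards [hlim δ hδ] with n hn t ht
  refine h _ ⟨ht, hq₀ t ht, by simpa using hu t⟩ _ ⟨ht, hq n t ht, by simpa using hu t⟩ ?_
  simpa [Prod.dist_eq, hδ] using hn t ht

lemma lipschitzWith_impulse (hT : 0 ≤ T) (hA : ContDiff ℝ 1 fun p : ℝ × Space => A p.1 p.2)
    (hΦ : IsScalarPotential T S Φ) {C : Set Space} (hCS : C ⊆ Sᶜ) {K : ℝ≥0}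
    (hK : ∀ t ∈ Icc 0 T, ∀ x ∈ C, ∀ a : Space, ‖a‖ ≤ 1 → ‖force A Φ t x a‖ ≤ K)
    {q u : ℝ → Space} (hq : IsLoop T S q u) (hqC : ∀ t ∈ Icc 0 T, q t ∈ C) :
    LipschitzWith K (impulse T A Φ q u) := by
  refine lipschitzWith_of_nnnorm_deriv_le (𝕜 := ℝ)
    (fun t => (hasDerivAt_impulse hT hA hΦ hq.continuous hq.continuous_velocity
      (fun t ht => hCS (hqC t ht)) t).differentiableAt) fun t => ?_
  rw [(hasDerivAt_impulse hT hA hΦ hq.continuous hq.continuous_velocity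
      (fun t ht => hCS (hqC t ht)) t).deriv]
  have := clamp_mem hT t
  exact hK _ this _ (hqC _ this) _ (hq.speed _ this)

variable {m : ℝ} {q u : ℕ → ℝ → Space} {C : Set Space}

/-- Stationarity of minimizing sequences with respect to translations. -/
lemma tendsto_impulse_period (hT : 0 < T) (hA : ContDiff ℝ 1 fun p : ℝ × Space => A p.1 p.2)
    (hΦ : IsScalarPotential T S Φ) (hS : IsClosed S) (hC : IsCompact C) (hCS : C ⊆ Sᶜ)
    (hm : ∀ q u, IsLoop T S q u → m ≤ action T A Φ q u) (hloop : ∀ n, IsLoop T S (q n) (u n))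
    (hqC : ∀ n, ∀ t ∈ Icc 0 T, q n t ∈ C)
    (hact : Tendsto (fun n => action T A Φ (q n) (u n)) atTop (𝓝 m)) :
    Tendsto (fun n => impulse T A Φ (q n) (u n) T) atTop (𝓝 0) := by
  obtain ⟨K, hK⟩ := exists_norm_force_le (T := T) hA hΦ hC hCS
  have hb : ∀ n, ‖impulse T A Φ (q n) (u n) T‖ ≤ K * T := fun n => by
    have := (lipschitzWith_impulse hT.le hA hΦ hCS hK (hloop n) (hqC n)).dist_le_mul T 0
    simpa [impulse_zero, Real.norm_of_nonneg hT.le] using this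
  rw [Metric.tendsto_nhds]
  intro ε hε
  obtain ⟨δ, hδ, h⟩ := exists_integral_kinetic_le hT hA hΦ hS hC hCS
    (show 0 ≤ K * T by positivity) (show 0 < ε ^ 2 / 2 by positivity) hm
  filter_upwards [hact.eventually_le_const (show m < m + δ by linarith)] with n hn
  -- A translation leaves the velocity unchanged. Choosing it opposite to the total impulse bounds
  -- the square of that impulse by `ε ^ 2 / 2`.
  have h1 := h (q n) (u n) (fun _ => -impulse T A Φ (q n) (u n) T) (fun _ => 0) (hloop n) (hqC n)
    hn (fun t => hasDerivAt_const t _) continuous_const rfl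
    (fun _ _ => by rw [norm_neg]; exact hb n) (fun t ht => by simpa using (hloop n).speed t ht)
  rw [integral_interactionVar hT.le hA hΦ (hloop n) (fun t => hasDerivAt_const t _)
    continuous_const] at h1
  simp only [add_zero, inner_zero_left, intervalIntegral.integral_zero, zero_add, inner_neg_right,
    real_inner_self_eq_norm_sq] at h1
  rw [dist_zero_right]
  nlinarith [norm_nonneg (impulse T A Φ (q n) (u n) T)]

/-- Strong convergence of the velocities of a minimizing sequence. -/
lemma tendsto_integral_sq_sub_velocity (hT : 0 < T)
    (hA : ContDiff ℝ 1 fun p : ℝ × Space => A p.1 p.2)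
    (hΦ : IsScalarPotential T S Φ) (hS : IsClosed S) (hC : IsCompact C) (hCS : C ⊆ Sᶜ)
    (hm : ∀ q u, IsLoop T S q u → m ≤ action T A Φ q u) (hloop : ∀ n, IsLoop T S (q n) (u n))
    (hqC : ∀ n, ∀ t ∈ Icc 0 T, q n t ∈ C)
    (hact : Tendsto (fun n => action T A Φ (q n) (u n)) atTop (𝓝 m))
    {M : ℝ → Space} (hMc : Continuous M) (hM : TendstoUniformlyOn
      (fun n t => A t (q n t) - impulse T A Φ (q n) (u n) t) M atTop (Icc 0 T))
    {l : Space} (hl : ∫ t in (0 : ℝ)..T, velocity (-M t + l) = 0) :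
    Tendsto (fun n => ∫ t in (0 : ℝ)..T, ‖u n t - velocity (-M t + l)‖ ^ 2) atTop (𝓝 0) := by
  set P : ℝ → Space := fun t => -M t + l with hP
  set U : ℝ → Space := fun t => velocity (P t) with hU
  have hPc : Continuous P := by fun_prop
  have hUc : Continuous U := continuous_velocity.comp hPc
  have hkc := continuous_kinetic
  set w : ℝ → Space := fun t => ∫ s in (0 : ℝ)..t, U s with hw
  have hwd : ∀ t, HasDerivAt w (U t) t := fun t => (hUc.integral_hasStrictDerivAt 0 t).hasDerivAt
  have hwc := continuous_of_hasDerivAt hwd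
  have hw0 : w 0 = 0 := by simp [hw]
  have hwT : w T = 0 := hl
  obtain ⟨R, hR⟩ := hC.isBounded.exists_norm_le
  obtain ⟨R', hR'⟩ := isCompact_Icc.exists_bound_of_continuousOn (s := Icc 0 T) hwc.continuousOn
  set V := |R| + |R'| with hV
  have hV0 : 0 ≤ V := by positivity
  have hvV : ∀ n, ∀ t ∈ Icc 0 T, ‖w t - q n t‖ ≤ V := fun n t ht => by
    have := norm_sub_le (w t) (q n t)
    have := hR' t ht
    have := hR _ (hqC n t ht)
    linarith [le_abs_self R, le_abs_self R']
  have himp := tendsto_impulse_period hT hA hΦ hS hC hCS hm hloop hqC hact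
  rw [Metric.tendsto_nhds]
  intro ε hε
  obtain ⟨δ, hδ, h⟩ := exists_integral_kinetic_le hT hA hΦ hS hC hCS hV0
    (show 0 < ε / 8 by positivity) hm
  rw [Metric.tendsto_nhds] at himp
  rw [Metric.tendstoUniformlyOn_iff] at hM
  filter_upwards [hact.eventually_le_const (show m < m + δ by linarith),
    himp (ε / (8 * (V + 1))) (by positivity), hM (ε / (16 * T)) (by positivity)] with n hn h2 h3
  have huc := (hloop n).continuous_velocity
  have hqc := (hloop n).continuous
  have hGc : Continuous (impulse T A Φ (q n) (u n)) := continuous_of_hasDerivAt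
    (hasDerivAt_impulse hT.le hA hΦ hqc huc (hloop n).mem)
  have hAc : Continuous fun t => A t (q n t) :=
    hA.continuous.comp (by fun_prop : Continuous fun t => (t, q n t))
  have hvd : ∀ t, HasDerivAt (fun t => w t - q n t) (U t - u n t) t := fun t =>
    (hwd t).sub ((hloop n).hasDerivAt t)
  -- With this variation `u n + v'` is exactly `U`, of speed below one. That `w` starts at the
  -- origin, unrelated to `q n 0`, costs only a pairing with the total impulse, which tends to zero.
  have h1 := h (q n) (u n) (fun t => w t - q n t) (fun t => U t - u n t) (hloop n) (hqC n) hn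
    hvd (by fun_prop)
    (by rw [hw0, hwT, (hloop n).closed]) (hvV n)
    (fun t _ => by rw [add_sub_cancel]; exact (norm_velocity_lt_one _).le)
  rw [integral_interactionVar hT.le hA hΦ (hloop n) hvd (by fun_prop)] at h1
  simp only [add_sub_cancel] at h1
  have hGT : ⟪impulse T A Φ (q n) (u n) T, w T - q n T⟫ ≤ ε / 8 := by
    refine (real_inner_le_norm _ _).trans ?_
    rw [dist_zero_right, lt_div_iff₀ (by positivity)] at h2
    have := hvV n T ⟨hT.le, le_rfl⟩
    nlinarith [norm_nonneg (impulse T A Φ (q n) (u n) T)]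
  have hint : ∫ t in (0 : ℝ)..T, (U t - u n t) = 0 := by
    rw [intervalIntegral.integral_sub (hUc.intervalIntegrable _ _) (huc.intervalIntegrable _ _),
      intervalIntegral.integral_eq_sub_of_hasDerivAt (fun t _ => (hloop n).hasDerivAt t)
        (huc.intervalIntegrable _ _), (hloop n).closed, sub_self, sub_zero]
    exact hl
  -- Both `U` and `u n` have mean zero, so the unknown momentum constant `l` drops out of the
  -- comparison.
  have hintl : ∫ t in (0 : ℝ)..T, ⟪U t - u n t, l⟫ = 0 := by
    have h4 := (innerSL ℝ l).intervalIntegral_comp_comm ((hUc.sub huc).intervalIntegrable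
      (μ := volume) 0 T)
    simp only [Pi.sub_apply, innerSL_apply_apply] at h4
    rw [hint, inner_zero_right] at h4
    simpa only [real_inner_comm] using h4
  -- Strong convexity at momentum `P = -M + l`. Its right side is what the variational inequality
  -- controls, once `M` is replaced by its approximation at index `n`.
  have hle : ∫ t in (0 : ℝ)..T, ‖u n t - U t‖ ^ 2 / 2 ≤ ∫ t in (0 : ℝ)..T,
      (kinetic (u n t) - kinetic (U t) + (⟪U t - u n t, l⟫ + (ε / (8 * T) -
        ⟪U t - u n t, A t (q n t) - impulse T A Φ (q n) (u n) t⟫))) := by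
    refine intervalIntegral.integral_mono_on hT.le
      (Continuous.intervalIntegrable (by fun_prop) _ _)
      (Continuous.intervalIntegrable (by fun_prop) _ _) fun t ht => ?_
    have h4 := kinetic_sub_inner_ge ((hloop n).speed t ht) (P t)
    have h5 := h3 t ht
    rw [dist_eq_norm] at h5
    have h6 : ‖U t - u n t‖ ≤ 2 := by
      have := norm_sub_le (U t) (u n t)
      have : ‖U t‖ < 1 := norm_velocity_lt_one _
      linarith [(hloop n).speed t ht]
    have h7 := abs_real_inner_le_norm (U t - u n t)
      (M t - (A t (q n t) - impulse T A Φ (q n) (u n) t))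
    have h8 : ‖U t - u n t‖ * ‖M t - (A t (q n t) - impulse T A Φ (q n) (u n) t)‖ ≤
        2 * (ε / (16 * T)) := mul_le_mul h6 h5.le (norm_nonneg _) (by norm_num)
    have h9 : 2 * (ε / (16 * T)) = ε / (8 * T) := by field_simp; norm_num
    have h10 := (abs_le.1 (h7.trans h8)).1
    rw [inner_sub_right] at h10
    have h11 : ⟪u n t, P t⟫ = ⟪u n t, l⟫ - ⟪u n t, M t⟫ := by
      simp only [hP, inner_add_right, inner_neg_right]; ring
    have h12 : ⟪velocity (P t), P t⟫ = ⟪U t, l⟫ - ⟪U t, M t⟫ := by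
      change ⟪U t, P t⟫ = _
      simp only [hP, inner_add_right, inner_neg_right]; ring
    rw [h11, h12] at h4
    rw [inner_sub_left (U t) (u n t) l]
    rw [inner_sub_left (U t) (u n t) (M t)] at h10
    change kinetic (U t) - _ + ‖u n t - U t‖ ^ 2 / 2 ≤ _ at h4
    linarith
  have c1 : Continuous fun t => kinetic (u n t) := hkc.comp huc
  have c2 : Continuous fun t => kinetic (U t) := hkc.comp hUc
  have c3 : Continuous fun t => ⟪U t - u n t, l⟫ := by fun_prop
  have c4 : Continuous fun t => ⟪U t - u n t, A t (q n t) - impulse T A Φ (q n) (u n) t⟫ := by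
    fun_prop
  have i1 : IntervalIntegrable (fun t => kinetic (u n t)) volume 0 T := c1.intervalIntegrable _ _
  have i2 : IntervalIntegrable (fun t => kinetic (U t)) volume 0 T := c2.intervalIntegrable _ _
  have i3 : IntervalIntegrable (fun t => ⟪U t - u n t, l⟫) volume 0 T := c3.intervalIntegrable _ _
  have i4 : IntervalIntegrable (fun t => ⟪U t - u n t, A t (q n t) -
    impulse T A Φ (q n) (u n) t⟫) volume 0 T := c4.intervalIntegrable _ _
  have i5 : IntervalIntegrable (fun _ : ℝ => ε / (8 * T)) volume 0 T := by simp
  rw [intervalIntegral.integral_add (i1.sub i2) (i3.add (i5.sub i4)),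
    intervalIntegral.integral_sub i1 i2, intervalIntegral.integral_add i3 (i5.sub i4),
    intervalIntegral.integral_sub i5 i4, hintl, intervalIntegral.integral_const,
    intervalIntegral.integral_div] at hle
  have e : (T - 0) • (ε / (8 * T)) = ε / 8 := by rw [smul_eq_mul]; field_simp; ring
  rw [e] at hle
  have hnn : 0 ≤ ∫ t in (0 : ℝ)..T, ‖u n t - U t‖ ^ 2 :=
    intervalIntegral.integral_nonneg hT.le fun _ _ => sq_nonneg _
  rw [Real.dist_0_eq_abs]
  change |∫ t in (0 : ℝ)..T, ‖u n t - U t‖ ^ 2| < ε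
  rw [abs_of_nonneg hnn]
  linarith

end Convergence

/-! ### From minimizing sequences to extremals -/

section Extremal

variable {T : ℝ} {S : Set Space} {A : ℝ → Space → Space} {Φ : ℝ → Space → ℝ}

/-- Curves on `[0, T]` that solve the integrated equation of motion with momentum `P`. -/
structure IsExtremal (T : ℝ) (S : Set Space) (A : ℝ → Space → Space) (Φ : ℝ → Space → ℝ)
    (q P : ℝ → Space) : Prop where
  continuous_momentum : Continuous P
  hasDerivAt : ∀ t, HasDerivAt q (velocity (P t)) t
  mem : ∀ t ∈ Icc 0 T, q t ∈ Sᶜ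
  closed : q T = q 0
  momentum_closed : P T = P 0
  momentum_eq : ∀ t ∈ Icc 0 T, P t = P 0 - (A t (q t) - A 0 (q 0)) +
    impulse T A Φ q (fun t => velocity (P t)) t

lemma IsExtremal.isLoop {q P : ℝ → Space} (h : IsExtremal T S A Φ q P) :
    IsLoop T S q (fun t => velocity (P t)) :=
  ⟨h.hasDerivAt, continuous_velocity.comp h.continuous_momentum,
    fun _ _ => (norm_velocity_lt_one _).le, h.mem, h.closed⟩

variable {q u : ℕ → ℝ → Space} {C : Set Space}

/-- The force is affine in the velocity with bounded linear part, so `L¹` convergence of the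
velocities suffices; uniform convergence of the positions handles the rest. -/
lemma tendsto_impulse (hT : 0 < T) (hA : ContDiff ℝ 1 fun p : ℝ × Space => A p.1 p.2)
    (hΦ : IsScalarPotential T S Φ) (hC : IsCompact C) (hCS : C ⊆ Sᶜ)
    (hloop : ∀ n, IsLoop T S (q n) (u n))
    (hqC : ∀ n, ∀ t ∈ Icc 0 T, q n t ∈ C) {q₀ u₀ : ℝ → Space} (hq₀ : Continuous q₀)
    (hu₀ : Continuous u₀) (hu₁ : ∀ t, ‖u₀ t‖ ≤ 1) (hq₀C : ∀ t ∈ Icc 0 T, q₀ t ∈ C)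
    (hq : TendstoUniformlyOn q q₀ atTop (Icc 0 T))
    (hu : Tendsto (fun n => ∫ t in (0 : ℝ)..T, ‖u n t - u₀ t‖) atTop (𝓝 0)) {t : ℝ}
    (ht : t ∈ Icc 0 T) :
    Tendsto (fun n => impulse T A Φ (q n) (u n) t) atTop (𝓝 (impulse T A Φ q₀ u₀ t)) := by
  have hunif := tendstoUniformlyOn_comp_of_isCompact hC
    ((continuousOn_force hA hΦ).mono fun p hp => ⟨mem_univ _, hCS hp.2.1, mem_univ _⟩)
    hqC hq₀C hu₁ hq
  dsimp only at hunif
  obtain ⟨B, hB⟩ := (isCompact_Icc.prod hC).exists_bound_of_continuousOn (s := Icc 0 T ×ˢ C)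
    (continuous_fderiv_slice hA).continuousOn
  have hlip : ∀ t ∈ Icc 0 T, ∀ x ∈ C, ∀ a b : Space,
      ‖force A Φ t x a - force A Φ t x b‖ ≤ |B| * ‖a - b‖ := by
    intro t ht x hx a b
    rw [force, force, sub_sub_sub_cancel_right, ← map_sub]
    refine (ContinuousLinearMap.le_opNorm _ _).trans ?_
    rw [LinearIsometryEquiv.norm_map]
    exact mul_le_mul_of_nonneg_right ((hB (t, x) ⟨ht, hx⟩).trans (le_abs_self B)) (norm_nonneg _)
  rw [Metric.tendsto_nhds]
  intro ε hε
  rw [Metric.tendstoUniformlyOn_iff] at hunif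
  filter_upwards [hu.eventually_lt_const (show 0 < ε / (2 * (|B| + 1)) by positivity),
    hunif (ε / (2 * T)) (by positivity)] with n h1 h2
  have hqc := (hloop n).continuous
  have huc := (hloop n).continuous_velocity
  have hf := continuous_force_clamp hT.le hA hΦ hqc huc (hloop n).mem
  have hf₀ := continuous_force_clamp hT.le hA hΦ hq₀ hu₀ (fun t ht => hCS (hq₀C t ht))
  rw [dist_eq_norm, impulse, impulse, ← intervalIntegral.integral_sub (hf.intervalIntegrable _ _)
    (hf₀.intervalIntegrable _ _)]
  refine (norm_integral_le_integral_norm_of_mem (hf.sub hf₀) ht).trans_lt ?_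
  have h3 : ∫ s in (0 : ℝ)..T, ‖force A Φ (clamp T s) (q n (clamp T s)) (u n (clamp T s)) -
      force A Φ (clamp T s) (q₀ (clamp T s)) (u₀ (clamp T s))‖ ≤
      ∫ s in (0 : ℝ)..T, (|B| * ‖u n s - u₀ s‖ + ε / (2 * T)) := by
    refine intervalIntegral.integral_mono_on hT.le ((hf.sub hf₀).norm.intervalIntegrable _ _)
      (Continuous.intervalIntegrable (by fun_prop) _ _) fun s hs => ?_
    rw [clamp_of_mem hs]
    have h4 := hlip s hs _ (hqC n s hs) (u n s) (u₀ s)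
    have h5 := h2 s hs
    rw [dist_comm, dist_eq_norm] at h5
    have h6 := norm_sub_le_norm_sub_add_norm_sub (force A Φ s (q n s) (u n s))
      (force A Φ s (q n s) (u₀ s)) (force A Φ s (q₀ s) (u₀ s))
    linarith
  rw [intervalIntegral.integral_add (Continuous.intervalIntegrable (by fun_prop) _ _) (by simp),
    intervalIntegral.integral_const_mul, intervalIntegral.integral_const] at h3
  have e : (T - 0) • (ε / (2 * T)) = ε / 2 := by rw [smul_eq_mul]; field_simp; ring
  rw [e] at h3
  rw [lt_div_iff₀ (by positivity)] at h1
  have h7 : 0 ≤ ∫ t in (0 : ℝ)..T, ‖u n t - u₀ t‖ :=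
    intervalIntegral.integral_nonneg hT.le fun _ _ => norm_nonneg _
  refine h3.trans_lt ?_
  nlinarith

/-- A minimizing sequence that stays in a compact subset of `Sᶜ` converges, along a subsequence,
to an extremal. -/
theorem exists_isExtremal (hT : 0 < T) (hA : IsVectorPotential T A)
    (hΦ : IsScalarPotential T S Φ) (hS : IsClosed S) (hC : IsCompact C) (hCS : C ⊆ Sᶜ) {m : ℝ}
    (hm : ∀ q u, IsLoop T S q u → m ≤ action T A Φ q u) (hloop : ∀ n, IsLoop T S (q n) (u n))
    (hqC : ∀ n, ∀ t ∈ Icc 0 T, q n t ∈ C)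
    (hact : Tendsto (fun n => action T A Φ (q n) (u n)) atTop (𝓝 m)) :
    ∃ (φ : ℕ → ℕ) (q₀ P : ℝ → Space), StrictMono φ ∧ IsExtremal T S A Φ q₀ P ∧
      TendstoUniformlyOn (fun n => q (φ n)) q₀ atTop (Icc 0 T) ∧
      Tendsto (fun n => ∫ t in (0 : ℝ)..T, ‖u (φ n) t - velocity (P t)‖) atTop (𝓝 0) := by
  have hA' := hA.contDiff
  obtain ⟨R, hR⟩ := hC.isBounded.exists_norm_le
  obtain ⟨Q, φ₁, hQc, hφ₁, hQ⟩ := exists_subseq_tendstoUniformlyOn hT.le (K := 1) (f := q) (R := R)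
    (fun n => LipschitzOnWith.of_dist_le_mul fun s hs t ht => by
      rw [dist_comm, dist_eq_norm, dist_comm, Real.dist_eq, NNReal.coe_one, one_mul]
      exact (hloop n).norm_sub_le hs ht)
    fun n t ht => hR _ (hqC n t ht)
  obtain ⟨K, hK⟩ := exists_norm_force_le (T := T) hA' hΦ hC hCS
  have hGL := fun n => lipschitzWith_impulse hT.le hA' hΦ hCS hK (hloop n) (hqC n)
  obtain ⟨G, φ₂, hGc, hφ₂, hG⟩ := exists_subseq_tendstoUniformlyOn hT.le (K := K) (R := K * T)
    (f := fun n => impulse T A Φ (q (φ₁ n)) (u (φ₁ n))) (fun n => (hGL _).lipschitzOnWith)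
    fun n t ht => by
      have := (hGL (φ₁ n)).dist_le_mul t 0
      rw [impulse_zero, dist_zero_right, Real.dist_eq, sub_zero, abs_of_nonneg ht.1] at this
      exact this.trans (mul_le_mul_of_nonneg_left ht.2 K.2)
  set φ : ℕ → ℕ := fun n => φ₁ (φ₂ n) with hφdef
  have hφ : StrictMono φ := hφ₁.comp hφ₂
  have hQ' : TendstoUniformlyOn (fun n => q (φ n)) Q atTop (Icc 0 T) :=
    fun s hs => hφ₂.tendsto_atTop.eventually (hQ s hs)
  have hact' := hact.comp hφ.tendsto_atTop
  have hQC : ∀ t ∈ Icc 0 T, Q t ∈ C := fun t ht =>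
    hC.isClosed.mem_of_tendsto (hQ'.tendsto_at ht) (Eventually.of_forall fun n => hqC _ t ht)
  have hAlim := tendstoUniformlyOn_comp_of_isCompact (T := T) (G := fun p => A p.1 p.2.1) (u := 0) hC
    (hA'.continuous.comp (by fun_prop : Continuous fun p : ℝ × Space × Space =>
      (p.1, p.2.1))).continuousOn (fun n => hqC (φ n)) hQC (by simp) hQ'
  have hMlim := hAlim.sub hG
  have hend := tendsto_impulse_period hT hA' hΦ hS hC hCS hm (fun n => hloop (φ n))
    (fun n => hqC (φ n)) hact'
  -- Together with the periodicity of `A`, this makes the limit momentum take equal values at `0`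
  -- and `T`.
  have hGT : G T = 0 := tendsto_nhds_unique (hG.tendsto_at ⟨hT.le, le_rfl⟩) hend
  have hG0 : G 0 = 0 := tendsto_nhds_unique (hG.tendsto_at ⟨le_rfl, hT.le⟩)
    (by simp [impulse_zero])
  set M : ℝ → Space := fun t => A t (Q t) - G t with hM
  have hMc : Continuous M :=
    (hA'.continuous.comp (by fun_prop : Continuous fun t => (t, Q t))).sub hGc
  obtain ⟨l, hl⟩ := exists_integral_velocity_eq_zero hT hMc.neg
  have hL2 := tendsto_integral_sq_sub_velocity hT hA' hΦ hS hC hCS hm (fun n => hloop (φ n))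
    (fun n => hqC (φ n)) hact' hMc hMlim hl
  set P : ℝ → Space := fun t => -M t + l with hP
  have hPc : Continuous P := hMc.neg.add continuous_const
  set U : ℝ → Space := fun t => velocity (P t) with hU
  have hUc : Continuous U := continuous_velocity.comp hPc
  have hL1 : Tendsto (fun n => ∫ t in (0 : ℝ)..T, ‖u (φ n) t - U t‖) atTop (𝓝 0) :=
    tendsto_integral_norm_of_sq hT (fun n => (hloop (φ n)).continuous_velocity.sub hUc) hL2
  -- The uniform limit `Q` is not known to be differentiable. It is identified on `[0, T]` with this
  -- primitive of `U`, which is differentiable on the whole line.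
  set q₀ : ℝ → Space := fun t => Q 0 + ∫ s in (0 : ℝ)..t, U s with hq₀
  have hq₀d : ∀ t, HasDerivAt q₀ (U t) t := fun t =>
    ((hUc.integral_hasStrictDerivAt 0 t).hasDerivAt).const_add _
  have hq₀Q : ∀ t ∈ Icc 0 T, Q t = q₀ t := by
    intro t ht
    have h1 : Tendsto (fun n => ∫ s in (0 : ℝ)..t, (u (φ n) s - U s)) atTop (𝓝 0) :=
      squeeze_zero_norm (fun n => norm_integral_le_integral_norm_of_mem
        ((hloop (φ n)).continuous_velocity.sub hUc) ht) hL1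
    have h2 : ∀ n, ∫ s in (0 : ℝ)..t, (u (φ n) s - U s) =
        q (φ n) t - q (φ n) 0 - ∫ s in (0 : ℝ)..t, U s := fun n => by
      rw [intervalIntegral.integral_sub
        ((hloop (φ n)).continuous_velocity.intervalIntegrable _ _) (hUc.intervalIntegrable _ _),
        intervalIntegral.integral_eq_sub_of_hasDerivAt (fun t _ => (hloop (φ n)).hasDerivAt t)
        ((hloop (φ n)).continuous_velocity.intervalIntegrable _ _)]
    simp_rw [h2] at h1
    have h3 := tendsto_nhds_unique h1 (((hQ'.tendsto_at ht).sub
      (hQ'.tendsto_at ⟨le_rfl, hT.le⟩)).sub_const _)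
    rw [hq₀]
    dsimp only
    rw [eq_comm, sub_eq_zero] at h3
    rw [← h3]; abel
  have hq₀lim : TendstoUniformlyOn (fun n => q (φ n)) q₀ atTop (Icc 0 T) :=
    hQ'.congr_right hq₀Q
  have hq₀C : ∀ t ∈ Icc 0 T, q₀ t ∈ C := fun t ht => hq₀Q t ht ▸ hQC t ht
  have hclosed : q₀ T = q₀ 0 := by
    rw [← hq₀Q T ⟨hT.le, le_rfl⟩, ← hq₀Q 0 ⟨le_rfl, hT.le⟩]
    refine tendsto_nhds_unique (hQ'.tendsto_at ⟨hT.le, le_rfl⟩) ?_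
    simp_rw [fun n => (hloop (φ n)).closed]
    exact hQ'.tendsto_at ⟨le_rfl, hT.le⟩
  have hGeq : ∀ t ∈ Icc 0 T, G t = impulse T A Φ q₀ U t := fun t ht =>
    tendsto_nhds_unique (hG.tendsto_at ht) (tendsto_impulse hT hA' hΦ hC hCS
      (fun n => hloop (φ n)) (fun n => hqC (φ n)) (continuous_of_hasDerivAt hq₀d) hUc
      (fun t => (norm_velocity_lt_one _).le) hq₀C hq₀lim hL1 ht)
  have hQT : Q T = Q 0 := by
    rw [hq₀Q T ⟨hT.le, le_rfl⟩, hq₀Q 0 ⟨le_rfl, hT.le⟩, hclosed]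
  have hAT : A T (Q T) = A 0 (Q 0) := by
    rw [hQT]; simpa using hA.periodic 0 (Q 0)
  refine ⟨φ, q₀, P, hφ, ⟨hPc, hq₀d, fun t ht => hCS (hq₀C t ht), hclosed, ?_, fun t ht => ?_⟩,
    hq₀lim, hL1⟩
  · simp only [hP, hM, hAT, hGT, hG0]
  · rw [← hGeq t ht, ← hq₀Q t ht, ← hq₀Q 0 ⟨le_rfl, hT.le⟩]
    simp only [hP, hM, hG0]
    abel

end Extremal

/-! ### Extremals extend to periodic solutions -/

section Periodic

variable {T : ℝ} {S : Set Space} {A : ℝ → Space → Space} {Φ : ℝ → Space → ℝ}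

/-- A coordinate computation. The term `-(DF) u` is the one that combines with `-∂ₜA` into minus the
total derivative of `A` along the curve, leaving only `force`. -/
lemma cross_curl (F : Space → Space) (x u : Space) :
    cross u (curl F x) = ContinuousLinearMap.adjoint (fderiv ℝ F x) u - fderiv ℝ F x u := by
  set L := fderiv ℝ F x with hL
  have h1 : ∀ i, (L u) i = ∑ j, u j * (L (EuclideanSpace.single j 1)) i := by
    intro i
    have hu : u = ∑ j, u j • EuclideanSpace.single j (1 : ℝ) := by
      ext k
      simp [Finset.sum_apply, Pi.single_apply]
    conv_lhs => rw [hu]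
    simp
  have h2 : ∀ i, (ContinuousLinearMap.adjoint L u) i =
      ∑ j, u j * (L (EuclideanSpace.single i 1)) j := by
    intro i
    have : (ContinuousLinearMap.adjoint L u) i =
        ⟪EuclideanSpace.single i (1 : ℝ), ContinuousLinearMap.adjoint L u⟫ := by
      simp [EuclideanSpace.inner_single_left]
    rw [this, ContinuousLinearMap.adjoint_inner_right, PiLp.inner_apply]
    simp
  ext i
  rw [PiLp.sub_apply, h1, h2, Fin.sum_univ_three, Fin.sum_univ_three]
  fin_cases i <;> simp [cross, curl, partialD, ← hL, cross_apply] <;> ring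

/-- The Lorentz force, rewritten as total derivatives. -/
lemma electricField_add_cross (t : ℝ) (x u : Space) :
    electricField A Φ t x + cross u (magneticField A t x) =
      force A Φ t x u - (timeDeriv A t x + fderiv ℝ (A t) x u) := by
  rw [electricField, magneticField, cross_curl, force]
  abel

lemma IsVectorPotential.periodic_fun (hA : IsVectorPotential T A) (t : ℝ) : A (t + T) = A t :=
  funext (hA.periodic t)

lemma IsVectorPotential.timeDeriv_periodic (hA : IsVectorPotential T A) (t : ℝ) (x : Space) :
    timeDeriv A (t + T) x = timeDeriv A t x := by
  have h : (fun s => A s x) = fun s => A (s + T) x := funext fun s => (hA.periodic s x).symm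
  rw [timeDeriv, timeDeriv]
  conv_rhs => rw [h]
  exact (deriv_comp_add_const (fun s => A s x) T t).symm

lemma IsScalarPotential.gradient_periodic (hΦ : IsScalarPotential T S Φ) (hS : IsClosed S) (t : ℝ)
    {x : Space} (hx : x ∈ Sᶜ) : gradient (Φ (t + T)) x = gradient (Φ t) x := by
  have h : Φ (t + T) =ᶠ[𝓝 x] Φ t :=
    eventually_of_mem (hS.isOpen_compl.mem_nhds hx) fun y hy => hΦ.periodic t y hy
  rw [gradient, gradient, h.fderiv_eq]

lemma force_periodic (hA : IsVectorPotential T A) (hΦ : IsScalarPotential T S Φ) (hS : IsClosed S)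
    (t : ℝ) {x : Space} (hx : x ∈ Sᶜ) (u : Space) :
    force A Φ (t + T) x u = force A Φ t x u := by
  rw [force, force, hA.periodic_fun, hΦ.gradient_periodic hS t hx]

lemma exists_periodic_extension (hT : 0 < T) {P : ℝ → Space} (hP : Continuous P) (h : P T = P 0) :
    ∃ P' : ℝ → Space, Continuous P' ∧ Function.Periodic P' T ∧ ∀ t ∈ Icc 0 T, P' t = P t := by
  have : Fact (0 < T) := ⟨hT⟩
  have hper : Function.Periodic (fun t : ℝ => AddCircle.liftIco T 0 P (t : AddCircle T)) T :=
    fun t => by simp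
  have hIco : ∀ t ∈ Ico 0 T, AddCircle.liftIco T 0 P (t : AddCircle T) = P t := fun t ht =>
    AddCircle.liftIco_zero_coe_apply ht
  refine ⟨fun t => AddCircle.liftIco T 0 P (t : AddCircle T),
    (AddCircle.liftIco_zero_continuous h.symm hP.continuousOn).comp
      (AddCircle.continuous_mk' T), hper, fun t ht => ?_⟩
  rcases ht.2.lt_or_eq with h1 | h1
  · exact hIco t ⟨ht.1, h1⟩
  · have h2 := hper 0
    rw [zero_add] at h2
    rw [h1, h, ← hIco 0 ⟨le_rfl, hT⟩]
    exact h2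

lemma integral_add_period {F : ℝ → Space} (hF : Continuous F) (hper : Function.Periodic F T)
    (h0 : ∫ t in (0 : ℝ)..T, F t = 0) (t : ℝ) :
    ∫ s in (0 : ℝ)..t + T, F s = ∫ s in (0 : ℝ)..t, F s := by
  have h1 := intervalIntegral.integral_add_adjacent_intervals (hF.intervalIntegrable (μ := volume) 0 t)
    (hF.intervalIntegrable t (t + T))
  have h2 := hper.intervalIntegral_add_eq t 0
  rw [zero_add, h0] at h2
  rw [h2, add_zero] at h1
  exact h1.symm

/-- The periodic extension of an extremal solves the Lorentz force equation. -/
theorem IsExtremal.exists_isPeriodicSolution (hT : 0 < T) (hA : IsVectorPotential T A)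
    (hΦ : IsScalarPotential T S Φ) (hS : IsClosed S) {q P : ℝ → Space}
    (h : IsExtremal T S A Φ q P) :
    ∃ q' : ℝ → Space, IsPeriodicSolution T S A Φ q' ∧ ∀ t ∈ Icc 0 T, q' t = q t := by
  have hA' := hA.contDiff
  -- The momentum is extended periodically and the curve recovered from it by integration, so no
  -- derivatives need to be matched at the multiples of `T`.
  obtain ⟨p, hpc, hpper, hpP⟩ := exists_periodic_extension hT h.continuous_momentum
    h.momentum_closed
  set U : ℝ → Space := fun t => velocity (p t) with hU
  have hUc : Continuous U := continuous_velocity.comp hpc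
  have hUper : Function.Periodic U T := fun t => by simp only [hU, hpper t]
  have hUP : ∀ t ∈ Icc 0 T, U t = velocity (P t) := fun t ht => by simp only [hU, hpP t ht]
  set r : ℝ → Space := fun t => q 0 + ∫ s in (0 : ℝ)..t, U s with hr
  have hrd : ∀ t, HasDerivAt r (U t) t := fun t =>
    ((hUc.integral_hasStrictDerivAt 0 t).hasDerivAt).const_add _
  have hrc := continuous_of_hasDerivAt hrd
  have hint : ∀ t ∈ Icc 0 T, ∫ s in (0 : ℝ)..t, U s = q t - q 0 := by
    intro t ht
    rw [← intervalIntegral.integral_eq_sub_of_hasDerivAt (fun t _ => h.hasDerivAt t)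
      ((h.isLoop.continuous_velocity).intervalIntegrable _ _)]
    refine intervalIntegral.integral_congr fun s hs => ?_
    rw [uIcc_of_le ht.1] at hs
    exact hUP s ⟨hs.1, hs.2.trans ht.2⟩
  have hrq : ∀ t ∈ Icc 0 T, r t = q t := fun t ht => by
    simp only [hr, hint t ht]; abel
  have hrper : Function.Periodic r T := fun t => by
    simp only [hr]
    rw [integral_add_period hUc hUper
      (by rw [hint T ⟨hT.le, le_rfl⟩, h.closed, sub_self]) t]
  have hrmem : ∀ t, r t ∈ Sᶜ := by
    intro t
    obtain ⟨s, hs, hst⟩ := hrper.exists_mem_Ico₀ hT t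
    rw [hst, hrq s (Ico_subset_Icc_self hs)]
    exact h.mem s (Ico_subset_Icc_self hs)
  set F : ℝ → Space := fun t =>
    force A Φ t (r t) (U t) - (timeDeriv A t (r t) + fderiv ℝ (A t) (r t) (U t)) with hF
  have hfc : Continuous fun t => force A Φ t (r t) (U t) := by
    have hmaps : ∀ t, (t, r t, U t) ∈ ((univ : Set ℝ) ×ˢ Sᶜ ×ˢ (univ : Set Space)) :=
      fun t => ⟨mem_univ t, hrmem t, mem_univ (U t)⟩
    exact ContinuousOn.comp_continuous (f := fun t => (t, r t, U t)) (continuousOn_force hA' hΦ)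
      (by fun_prop) hmaps
  have htr : Continuous fun t => (t, r t) := by fun_prop
  have hdc : Continuous fun t => timeDeriv A t (r t) + fderiv ℝ (A t) (r t) (U t) :=
    ((continuous_timeDeriv hA').comp htr).add
      (((continuous_fderiv_slice hA').comp htr).clm_apply hUc)
  have hFc : Continuous F := hfc.sub hdc
  have hFper : Function.Periodic F T := fun t => by
    simp only [hF, hrper t, hUper t, hA.timeDeriv_periodic, hA.periodic_fun,
      force_periodic hA hΦ hS t (hrmem t)]
  have hFint : ∀ t ∈ Icc 0 T, p t = p 0 + ∫ s in (0 : ℝ)..t, F s := by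
    intro t ht
    have h0 : (0 : ℝ) ∈ Icc 0 T := ⟨le_rfl, hT.le⟩
    rw [intervalIntegral.integral_sub (hfc.intervalIntegrable _ _) (hdc.intervalIntegrable _ _),
      intervalIntegral.integral_eq_sub_of_hasDerivAt (fun s _ => hasDerivAt_along hA' (hrd s))
      (hdc.intervalIntegrable _ _), hpP t ht, hpP 0 h0, hrq t ht, hrq 0 h0, h.momentum_eq t ht,
      impulse]
    have : ∫ s in (0 : ℝ)..t, force A Φ (clamp T s) (q (clamp T s)) (velocity (P (clamp T s))) =
        ∫ s in (0 : ℝ)..t, force A Φ s (r s) (U s) := by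
      refine intervalIntegral.integral_congr fun s hs => ?_
      rw [uIcc_of_le ht.1] at hs
      have hs' : s ∈ Icc 0 T := ⟨hs.1, hs.2.trans ht.2⟩
      simp only [clamp_of_mem hs', hrq s hs', hUP s hs']
    rw [this]
    abel
  have hF0 : ∫ t in (0 : ℝ)..T, F t = 0 := by
    have h1 := hFint T ⟨hT.le, le_rfl⟩
    have h2 := hpper 0
    rw [zero_add] at h2
    rw [h2] at h1
    simpa using h1
  have hpF : ∀ t, p t = p 0 + ∫ s in (0 : ℝ)..t, F s := by
    intro t
    -- The force has mean zero, so its primitive is periodic like `p`; their difference, constant on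
    -- `[0, T]`, is constant everywhere.
    have hdper : Function.Periodic (fun t => p t - ∫ s in (0 : ℝ)..t, F s) T := fun t => by
      simp only [hpper t]
      rw [integral_add_period hFc hFper hF0 t]
    obtain ⟨s, hs, hst⟩ := hdper.exists_mem_Ico₀ hT t
    rw [hFint s (Ico_subset_Icc_self hs), add_sub_cancel_right] at hst
    rw [← hst, sub_add_cancel]
  have hpd : ∀ t, HasDerivAt p (F t) t := by
    intro t
    rw [funext hpF]
    exact ((hFc.integral_hasStrictDerivAt 0 t).hasDerivAt).const_add _
  have hrderiv : deriv r = U := funext fun t => (hrd t).deriv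
  have hp1 : ContDiff ℝ 1 p := contDiff_one_iff_deriv.2
    ⟨fun t => (hpd t).differentiableAt, by rw [funext fun t => (hpd t).deriv]; exact hFc⟩
  have hmom : momentum r = p := funext fun t => by
    rw [momentum, hrderiv]
    exact momentum_velocity (p t)
  refine ⟨r, ⟨?_, hrper, hrmem, fun t => ?_, fun t => ?_⟩, hrq⟩
  · rw [show (2 : WithTop ℕ∞) = 1 + 1 from rfl, contDiff_succ_iff_deriv]
    refine ⟨fun t => (hrd t).differentiableAt, by simp, ?_⟩
    rw [hrderiv]
    exact contDiff_velocity.comp hp1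
  · rw [hrderiv]; exact norm_velocity_lt_one _
  · rw [hmom, hrderiv, electricField_add_cross]
    exact hpd t

end Periodic

/-! ### Lower bounds for the action: at infinity and near the singular set -/

section Bounds

variable {T : ℝ} {S : Set Space} {A : ℝ → Space → Space} {Φ : ℝ → Space → ℝ}

lemma IsVectorPotential.exists_bound (hT : 0 < T) (hA : IsVectorPotential T A) :
    ∃ c, 0 ≤ c ∧ ∀ t x, ‖timeDeriv A t x‖ + ‖fderiv ℝ (A t) x‖ ≤ c := by
  obtain ⟨R, hR⟩ := hA.decay 1 one_pos
  obtain ⟨c, hc⟩ := (isCompact_Icc.prod (isCompact_closedBall (0 : Space) R))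
    |>.exists_bound_of_continuousOn (s := Icc 0 T ×ˢ Metric.closedBall (0 : Space) R)
    ((continuous_timeDeriv hA.contDiff).norm.add
      (continuous_fderiv_slice hA.contDiff).norm).continuousOn
  refine ⟨max c 1, by positivity, fun t x => ?_⟩
  rcases le_total R ‖x‖ with h | h
  · exact (hR t x h).le.trans (le_max_right _ _)
  · have hper : Function.Periodic (fun t => ‖timeDeriv A t x‖ + ‖fderiv ℝ (A t) x‖) T := fun t => by
      simp only [hA.timeDeriv_periodic, hA.periodic_fun]
    obtain ⟨s, hs, hst⟩ := hper.exists_mem_Ico₀ hT t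
    rw [hst]
    exact (le_abs_self _).trans ((hc (s, x) ⟨Ico_subset_Icc_self hs, by simpa using h⟩).trans
      (le_max_left _ _))

lemma IsLoop.continuous_potential {q u : ℝ → Space} (h : IsLoop T S q u)
    (hA : ContDiff ℝ 1 fun p : ℝ × Space => A p.1 p.2) : Continuous fun t => A t (q t) :=
  hA.continuous.comp ((by have := h.continuous; fun_prop) : Continuous fun t => (t, q t))

/-- The velocity of a closed curve has mean zero, so a constant may be subtracted from `A`. Along
the curve `A` moves by at most `c * T`. No bound on `A` itself is needed, only on its derivatives.
-/
lemma IsLoop.abs_integral_inner_le {q u : ℝ → Space} (h : IsLoop T S q u) (hT : 0 ≤ T)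
    (hA : ContDiff ℝ 1 fun p : ℝ × Space => A p.1 p.2) {c : ℝ}
    (hc : ∀ t ∈ Icc 0 T, ‖timeDeriv A t (q t)‖ + ‖fderiv ℝ (A t) (q t)‖ ≤ c) :
    |∫ t in (0 : ℝ)..T, ⟪u t, A t (q t)⟫| ≤ c * T ^ 2 := by
  have huc := h.continuous_velocity
  have hAc := h.continuous_potential hA
  have h0 : ∫ t in (0 : ℝ)..T, ⟪u t, A 0 (q 0)⟫ = 0 := by
    have h1 := (innerSL ℝ (A 0 (q 0))).intervalIntegral_comp_comm
      (huc.intervalIntegrable (μ := volume) 0 T)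
    rw [intervalIntegral.integral_eq_sub_of_hasDerivAt (fun t _ => h.hasDerivAt t)
      (huc.intervalIntegrable _ _), h.closed, sub_self, map_zero] at h1
    simpa only [innerSL_apply_apply, real_inner_comm] using h1
  have h2 : ∀ t ∈ Icc 0 T, ‖A t (q t) - A 0 (q 0)‖ ≤ c * T := by
    intro t ht
    have := (convex_Icc (0 : ℝ) T).norm_image_sub_le_of_norm_hasDerivWithin_le (C := c)
      (fun s _ => (hasDerivAt_along hA (h.hasDerivAt s)).hasDerivWithinAt)
      (fun s hs => by
        refine (norm_add_le _ _).trans (le_trans ?_ (hc s hs))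
        have h3 := (fderiv ℝ (A s) (q s)).le_opNorm (u s)
        have h4 := h.speed s hs
        have := mul_le_mul_of_nonneg_left h4 (norm_nonneg (fderiv ℝ (A s) (q s)))
        linarith) ⟨le_rfl, hT⟩ ht
    have hc0 : 0 ≤ c := le_trans (by positivity) (hc 0 ⟨le_rfl, hT⟩)
    rw [sub_zero, Real.norm_of_nonneg ht.1] at this
    exact this.trans (mul_le_mul_of_nonneg_left ht.2 hc0)
  have h5 : ∫ t in (0 : ℝ)..T, ⟪u t, A t (q t)⟫ =
      ∫ t in (0 : ℝ)..T, ⟪u t, A t (q t) - A 0 (q 0)⟫ := by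
    simp_rw [inner_sub_right]
    rw [intervalIntegral.integral_sub ((huc.inner hAc).intervalIntegrable _ _)
      (Continuous.intervalIntegrable (by fun_prop) _ _), h0, sub_zero]
  rw [h5, ← Real.norm_eq_abs]
  have h6 := intervalIntegral.norm_integral_le_of_norm_le_const (a := 0) (b := T) (C := c * T)
    (f := fun t => ⟪u t, A t (q t) - A 0 (q 0)⟫) fun t ht => by
      rw [uIoc_of_le hT] at ht
      have ht' := Ioc_subset_Icc_self ht
      refine (norm_inner_le_norm _ _).trans ?_
      have := mul_le_mul (h.speed t ht') (h2 t ht') (norm_nonneg _) zero_le_one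
      linarith
  rw [sub_zero, abs_of_nonneg hT] at h6
  linarith [h6]

lemma IsLoop.intervalIntegrable_scalar {q u : ℝ → Space} (h : IsLoop T S q u) (hT : 0 ≤ T)
    (hΦ : IsScalarPotential T S Φ) (hS : IsClosed S) :
    IntervalIntegrable (fun t => Φ t (q t)) volume 0 T := by
  apply ContinuousOn.intervalIntegrable
  rw [uIcc_of_le hT]
  have := h.continuous
  have hmaps : MapsTo (fun t => (t, q t)) (Icc 0 T) (univ ×ˢ Sᶜ) :=
    fun t ht => ⟨mem_univ t, h.mem t ht⟩
  exact ContinuousOn.comp (f := fun t => (t, q t)) (hΦ.continuousOn hS)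
    (by fun_prop : Continuous fun t => (t, q t)).continuousOn hmaps

lemma IsLoop.le_action {q u : ℝ → Space} (h : IsLoop T S q u) (hT : 0 ≤ T)
    (hA : ContDiff ℝ 1 fun p : ℝ × Space => A p.1 p.2)
    (hΦ : IsScalarPotential T S Φ) (hS : IsClosed S) :
    (∫ t in (0 : ℝ)..T, ⟪u t, A t (q t)⟫) - ∫ t in (0 : ℝ)..T, Φ t (q t) ≤ action T A Φ q u := by
  have huc := h.continuous_velocity
  have hAc := h.continuous_potential hA
  have i1 : IntervalIntegrable (fun t => ⟪u t, A t (q t)⟫) volume 0 T :=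
    (huc.inner hAc).intervalIntegrable _ _
  rw [← intervalIntegral.integral_sub i1 (h.intervalIntegrable_scalar hT hΦ hS), action]
  refine intervalIntegral.integral_mono_on hT (i1.sub (h.intervalIntegrable_scalar hT hΦ hS))
    (((continuous_kinetic.comp huc).intervalIntegrable _ _).add
      (h.intervalIntegrable_interaction hT hA hΦ hS)) fun t _ => ?_
  rw [interaction]
  linarith [kinetic_nonneg (u t)]

lemma exists_le_action (hT : 0 < T) (hA : IsVectorPotential T A)
    (hΦ : IsScalarPotential T S Φ) (hS : IsClosed S) :
    ∃ m, ∀ q u, IsLoop T S q u → m ≤ action T A Φ q u := by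
  obtain ⟨c, hc0, hc⟩ := hA.exists_bound hT
  obtain ⟨D, hD⟩ := hΦ.bddAbove
  refine ⟨-(c * T ^ 2) - D * T, fun q u h => le_trans ?_ (h.le_action hT.le hA.contDiff hΦ hS)⟩
  have h1 := (abs_le.1 (h.abs_integral_inner_le hT.le hA.contDiff fun t _ => hc t (q t))).1
  have h2 : ∫ t in (0 : ℝ)..T, Φ t (q t) ≤ ∫ t in (0 : ℝ)..T, D :=
    intervalIntegral.integral_mono_on hT.le (h.intervalIntegrable_scalar hT.le hΦ hS) (by simp)
      fun t ht => hD t _ (h.mem t ht)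
  rw [intervalIntegral.integral_const, smul_eq_mul, sub_zero] at h2
  linarith

/-- Far away from the origin the action is almost bounded below by its values at constants. -/
lemma exists_le_action_of_le_norm (hT : 0 < T) (hA : IsVectorPotential T A)
    (hΦ : IsScalarPotential T S Φ) (hS : IsCompact S) {ε : ℝ} (hε : 0 < ε) :
    ∃ R, ∀ q u, IsLoop T S q u → R ≤ ‖q 0‖ →
      -meanPotential T Φ (q 0) - ε ≤ action T A Φ q u := by
  -- Each of the two errors is the derivative bound times `T ^ 2`, hence `ε / 2`.
  obtain ⟨R₁, hR₁⟩ := hA.decay (ε / (2 * T ^ 2)) (by positivity)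
  obtain ⟨R₂, hR₂⟩ := hΦ.decay (ε / (2 * T ^ 2)) (by positivity)
  obtain ⟨R₃, hR₃⟩ := hS.isBounded.exists_norm_le
  -- The ball of radius `T` about `q 0` contains the whole loop. Starting at distance `R + T` keeps
  -- that convex ball in the decay region and off `S`, so the mean value inequality for `Φ` applies
  -- on it.
  set R := max R₁ (max R₂ (R₃ + 1)) with hR
  refine ⟨R + T, fun q u h hq => le_trans ?_ (h.le_action hT.le hA.contDiff hΦ hS.isClosed)⟩
  have hfar : ∀ x ∈ Metric.closedBall (q 0) T, R ≤ ‖x‖ := fun x hx => by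
    rw [Metric.mem_closedBall, dist_comm, dist_eq_norm] at hx
    linarith [norm_sub_norm_le (q 0) x]
  have hSc : Metric.closedBall (q 0) T ⊆ Sᶜ := fun x hx hxS => by
    have h1 := hfar x hx
    have h2 : R₃ + 1 ≤ R := (le_max_right _ _).trans (le_max_right _ _)
    linarith [hR₃ x hxS]
  have hball : ∀ t ∈ Icc 0 T, q t ∈ Metric.closedBall (q 0) T := fun t ht => by
    rw [Metric.mem_closedBall, dist_eq_norm]
    have := h.norm_sub_le ⟨le_rfl, hT.le⟩ ht
    rw [sub_zero, abs_of_nonneg ht.1] at this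
    exact this.trans ht.2
  have h1 := (abs_le.1 (h.abs_integral_inner_le hT.le hA.contDiff fun t ht =>
    (hR₁ t (q t) ((le_max_left _ _).trans (hfar _ (hball t ht)))).le)).1
  have hq0 : q 0 ∈ Sᶜ := h.mem 0 ⟨le_rfl, hT.le⟩
  have i0 : IntervalIntegrable (fun t => Φ t (q 0)) volume 0 T :=
    (hΦ.continuous_time _ hq0).intervalIntegrable _ _
  have h2 : ∫ t in (0 : ℝ)..T, Φ t (q t) ≤
      ∫ t in (0 : ℝ)..T, (Φ t (q 0) + ε / (2 * T ^ 2) * T) := by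
    refine intervalIntegral.integral_mono_on hT.le (h.intervalIntegrable_scalar hT.le hΦ hS.isClosed)
      (i0.add (by simp)) fun t ht => ?_
    have h3 := hΦ.abs_potential_sub_le hS.isClosed (t := t) (convex_closedBall (q 0) T) hSc
      (fun x hx => (hR₂ t x (hSc hx) (((le_max_left _ _).trans (le_max_right _ _)).trans
        (hfar x hx))).le) (Metric.mem_closedBall_self hT.le) (hball t ht)
    have h4 := hball t ht
    rw [Metric.mem_closedBall, dist_eq_norm] at h4
    have h5 : ε / (2 * T ^ 2) * ‖q t - q 0‖ ≤ ε / (2 * T ^ 2) * T :=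
      mul_le_mul_of_nonneg_left h4 (by positivity)
    linarith [le_abs_self (Φ t (q t) - Φ t (q 0))]
  rw [intervalIntegral.integral_add i0 (by simp), intervalIntegral.integral_const] at h2
  have e1 : (T - 0) • (ε / (2 * T ^ 2) * T) = ε / 2 := by rw [smul_eq_mul]; field_simp; ring
  have e2 : ε / (2 * T ^ 2) * T ^ 2 = ε / 2 := by field_simp
  rw [e1] at h2
  rw [e2] at h1
  rw [meanPotential]
  linarith

/-- Loops of bounded action keep a distance from the singular set. -/
lemma exists_le_dist_of_action_le (hT : 0 < T) (hA : IsVectorPotential T A)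
    (hΦ : IsScalarPotential T S Φ) (hS : IsCompact S) (m : ℝ) :
    ∃ δ > 0, ∀ q u, IsLoop T S q u → action T A Φ q u ≤ m →
      ∀ t ∈ Icc 0 T, ∀ y ∈ S, δ ≤ dist (q t) y := by
  by_contra hcon
  push Not at hcon
  choose q u hq hact t ht y hy hd using fun n : ℕ => hcon (1 / ((n : ℝ) + 1)) (by positivity)
  obtain ⟨⟨t₀, x₀⟩, ⟨ht₀, hx₀⟩, φ, hφ, hlim⟩ :=
    (isCompact_Icc.prod hS).tendsto_subseq (x := fun n => (t n, y n)) fun n => ⟨ht n, hy n⟩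
  have htlim : Tendsto (fun n => t (φ n)) atTop (𝓝 t₀) := (continuous_fst.tendsto _).comp hlim
  have hylim : Tendsto (fun n => y (φ n)) atTop (𝓝 x₀) := (continuous_snd.tendsto _).comp hlim
  have hdlim : Tendsto (fun n => dist (q (φ n) (t (φ n))) (y (φ n))) atTop (𝓝 0) :=
    squeeze_zero (fun _ => dist_nonneg) (fun n => (hd (φ n)).le)
      (tendsto_one_div_add_atTop_nhds_zero_nat.comp hφ.tendsto_atTop)
  have hqlim : Tendsto (fun n => q (φ n) (t (φ n))) atTop (𝓝 x₀) :=
    (tendsto_iff_of_dist hdlim).2 hylim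
  -- The limit lies in `S` and is approached by points of `Sᶜ`, so the Coulomb bound is available
  -- there.
  have hfr : x₀ ∈ frontier S := by
    rw [frontier_eq_closure_inter_closure]
    exact ⟨subset_closure hx₀, mem_closure_of_tendsto hqlim
      (Eventually.of_forall fun n => (hq (φ n)).mem _ (ht _))⟩
  obtain ⟨ε, hε, r, hr, hsing⟩ := hΦ.singular x₀ hfr t₀ ht₀
  obtain ⟨c, hc0, hc⟩ := hA.exists_bound hT
  obtain ⟨D', hD'⟩ := hΦ.bddAbove
  set D := |D'| with hDdef
  have hD : ∀ t, ∀ x ∈ Sᶜ, Φ t x ≤ D := fun t x hx => (hD' t x hx).trans (le_abs_self _)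
  -- `X` is the size of the logarithm that pushes the action to at least `m + 1`; `η` is then solved
  -- from `log ((η + T / 2) / η) ≥ X`.
  set X := (m + c * T ^ 2 + (D + r / (ε / 2)) * T + 1) / r with hX
  set η := T / 2 * Real.exp (-X) with hη
  have hη0 : 0 < η := by positivity
  have hlog : X ≤ Real.log ((η + T / 2) / η) := by
    rw [Real.le_log_iff_exp_le (by positivity), le_div_iff₀ hη0, hη, mul_left_comm, ← Real.exp_add,
      add_neg_cancel, Real.exp_zero]
    nlinarith
  set κ := min η (ε / 2) with hκ
  have hκ0 : 0 < κ := by positivity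
  have ev1 : ∀ᶠ n in atTop, dist (t (φ n)) t₀ < κ / 2 :=
    (Metric.tendsto_nhds.1 htlim) _ (by positivity)
  have ev2 : ∀ᶠ n in atTop, dist (q (φ n) (t (φ n))) x₀ < κ / 2 :=
    (Metric.tendsto_nhds.1 hqlim) _ (by positivity)
  obtain ⟨n, hn1, hn2⟩ := (ev1.and ev2).exists
  set n' := φ n
  -- Speed at most one gives `‖q s - x₀‖ < η + |s - t₀|`, so near `t₀` the singularity dominates `r
  -- / (η + |s - t₀|)`. Away from `t₀` that quotient is at most `r / (ε / 2)`, which the constant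
  -- absorbs.
  have hpt : ∀ s ∈ Icc 0 T, Φ s (q n' s) ≤
      (D + r / (ε / 2)) - r * (1 / (η + |s - t₀|)) := by
    intro s hs
    have hmem := (hq n').mem s hs
    rcases lt_or_ge |s - t₀| (ε / 2) with hlt | hge
    · have h1 : ‖q n' s - x₀‖ < κ + |s - t₀| := by
        have h2 := (hq n').norm_sub_le (ht n') hs
        have h3 := abs_sub_le s t₀ (t n')
        rw [dist_eq_norm] at hn2
        rw [Real.dist_eq, abs_sub_comm] at hn1
        have h4 := norm_sub_le_norm_sub_add_norm_sub (q n' s) (q n' (t n')) x₀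
        linarith
      have h5 : κ ≤ ε / 2 := min_le_right _ _
      have h6 : κ ≤ η := min_le_left _ _
      have h7 := hsing s (q n' s) hmem (by linarith) (by linarith)
      have hpos : 0 < ‖q n' s - x₀‖ := by
        rw [norm_pos_iff, sub_ne_zero]
        rintro h8
        exact hmem (h8 ▸ hx₀)
      have h9 : r * (1 / (η + |s - t₀|)) ≤ r / ‖q n' s - x₀‖ := by
        rw [mul_one_div]
        exact div_le_div_of_nonneg_left hr.le hpos (by linarith)
      have h10 : 0 ≤ D := abs_nonneg _
      have h11 : 0 ≤ r / (ε / 2) := by positivity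
      linarith
    · have h9 : r * (1 / (η + |s - t₀|)) ≤ r / (ε / 2) := by
        rw [mul_one_div]
        exact div_le_div_of_nonneg_left hr.le (by positivity) (by linarith)
      linarith [hD s _ hmem]
  have hcont : Continuous fun s : ℝ => 1 / (η + |s - t₀|) :=
    continuous_const.div (by fun_prop) fun t => by positivity
  have h1 : ∫ s in (0 : ℝ)..T, Φ s (q n' s) ≤
      ∫ s in (0 : ℝ)..T, ((D + r / (ε / 2)) - r * (1 / (η + |s - t₀|))) :=
    intervalIntegral.integral_mono_on hT.le
      ((hq n').intervalIntegrable_scalar hT.le hΦ hS.isClosed)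
      (Continuous.intervalIntegrable (by fun_prop) _ _) hpt
  rw [intervalIntegral.integral_sub (by simp) ((hcont.const_mul r).intervalIntegrable _ _),
    intervalIntegral.integral_const_mul, intervalIntegral.integral_const, smul_eq_mul,
    sub_zero] at h1
  have h2 := log_le_integral_inv_add_abs hη0 ht₀
  have h3 := (abs_le.1 ((hq n').abs_integral_inner_le hT.le hA.contDiff fun t _ => hc t _)).1
  have h4 := (hq n').le_action hT.le hA.contDiff hΦ hS.isClosed
  have h5 := hact n'
  have h6 : r * X ≤ r * ∫ s in (0 : ℝ)..T, 1 / (η + |s - t₀|) :=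
    mul_le_mul_of_nonneg_left (hlog.trans h2) hr.le
  have h7 : r * X = m + c * T ^ 2 + (D + r / (ε / 2)) * T + 1 := by
    rw [hX]; field_simp
  rw [h7] at h6
  linarith

end Bounds

/-! ### Existence of a non-constant solution -/

section Main

variable {T : ℝ} {S : Set Space} {A : ℝ → Space → Space} {Φ : ℝ → Space → ℝ}

lemma isLoop_const {b : Space} (hb : b ∈ Sᶜ) : IsLoop T S (fun _ => b) (fun _ => 0) :=
  ⟨fun t => hasDerivAt_const t b, continuous_const, by simp, fun _ _ => hb, rfl⟩

lemma action_const (b : Space) : action T A Φ (fun _ => b) (fun _ => 0) = -meanPotential T Φ b := by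
  simp [action, interaction, meanPotential]

/-- A constant solution sits at a point where the electric field vanishes at all times. -/
lemma IsPeriodicSolution.timeDeriv_eq {b : Space} {q : ℝ → Space}
    (h : IsPeriodicSolution T S A Φ q) (hq : ∀ t, q t = b) (t : ℝ) :
    timeDeriv A t b = -gradient (Φ t) b := by
  obtain rfl : q = fun _ => b := funext hq
  have h1 := h.equation t
  rw [deriv_const, electricField_add_cross, force] at h1
  have h2 : momentum (fun _ => b) = fun _ => 0 := funext fun t => by simp [momentum]
  rw [h2] at h1
  have h3 := h1.unique (hasDerivAt_const t 0)
  rw [map_zero, map_zero, zero_sub, add_zero, sub_eq_zero] at h3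
  exact h3.symm

/-- The action of a sequence that converges to a constant. -/
lemma neg_meanPotential_le (hT : 0 < T) (hA : ContDiff ℝ 1 fun p : ℝ × Space => A p.1 p.2)
    (hΦ : IsScalarPotential T S Φ) (hS : IsClosed S) {C : Set Space} (hC : IsCompact C)
    (hCS : C ⊆ Sᶜ) {m : ℝ} {q u : ℕ → ℝ → Space} (hloop : ∀ n, IsLoop T S (q n) (u n))
    (hqC : ∀ n, ∀ t ∈ Icc 0 T, q n t ∈ C)
    (hact : Tendsto (fun n => action T A Φ (q n) (u n)) atTop (𝓝 m)) {c : Space}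
    (hq : TendstoUniformlyOn q (fun _ => c) atTop (Icc 0 T))
    (hu : Tendsto (fun n => ∫ t in (0 : ℝ)..T, ‖u n t‖) atTop (𝓝 0)) :
    -meanPotential T Φ c ≤ m := by
  have hcC : c ∈ C := hC.isClosed.mem_of_tendsto (hq.tendsto_at (x := 0) ⟨le_rfl, hT.le⟩)
    (Eventually.of_forall fun n => hqC n 0 ⟨le_rfl, hT.le⟩)
  have hmaps : MapsTo (fun p : ℝ × Space × Space => (p.1, p.2.1))
      (Icc 0 T ×ˢ C ×ˢ Metric.closedBall 0 1) (univ ×ˢ Sᶜ) := fun p hp => ⟨mem_univ _, hCS hp.2.1⟩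
  have hΦlim := tendstoUniformlyOn_comp_of_isCompact (T := T) (G := fun p => Φ p.1 p.2.1) (u := 0) hC
    (ContinuousOn.comp (f := fun p : ℝ × Space × Space => (p.1, p.2.1)) (hΦ.continuousOn hS)
      (by fun_prop) hmaps) hqC (fun _ _ => hcC) (by simp) hq
  obtain ⟨B, hB⟩ := (isCompact_Icc.prod hC).exists_bound_of_continuousOn (s := Icc 0 T ×ˢ C)
    hA.continuous.continuousOn
  refine le_of_forall_pos_le_add fun ε hε => ?_
  have hlow : ∀ᶠ n in atTop, -meanPotential T Φ c - ε - B * ∫ t in (0 : ℝ)..T, ‖u n t‖ ≤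
      action T A Φ (q n) (u n) := by
    filter_upwards [Metric.tendstoUniformlyOn_iff.1 hΦlim (ε / T) (by positivity)] with n hn
    have huc := (hloop n).continuous_velocity
    have i1 := (hloop n).intervalIntegrable_scalar hT.le hΦ hS
    have i2 : IntervalIntegrable (fun t => Φ t c) volume 0 T :=
      (hΦ.continuous_time c (hCS hcC)).intervalIntegrable _ _
    have h1 : ∫ t in (0 : ℝ)..T, Φ t (q n t) ≤ ∫ t in (0 : ℝ)..T, (Φ t c + ε / T) := by
      refine intervalIntegral.integral_mono_on hT.le i1 (i2.add (by simp)) fun t ht => ?_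
      have h2 := hn t ht
      rw [Real.dist_eq] at h2
      linarith [neg_abs_le (Φ t c - Φ t (q n t))]
    rw [intervalIntegral.integral_add i2 (by simp), intervalIntegral.integral_const, sub_zero,
      smul_eq_mul, mul_div_cancel₀ _ hT.ne'] at h1
    have h3 : ∫ t in (0 : ℝ)..T, -(B * ‖u n t‖) ≤ ∫ t in (0 : ℝ)..T, ⟪u n t, A t (q n t)⟫ := by
      refine intervalIntegral.integral_mono_on hT.le (Continuous.intervalIntegrable (by fun_prop) _ _)
        ((huc.inner ((hloop n).continuous_potential hA)).intervalIntegrable _ _) fun t ht => ?_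
      have h4 := (abs_le.1 (abs_real_inner_le_norm (u n t) (A t (q n t)))).1
      have h5 := mul_le_mul_of_nonneg_left (hB (t, q n t) ⟨ht, hqC n t ht⟩) (norm_nonneg (u n t))
      linarith
    rw [intervalIntegral.integral_neg, intervalIntegral.integral_const_mul] at h3
    have h6 := (hloop n).le_action hT.le hA hΦ hS
    rw [meanPotential]
    linarith
  have h7 := le_of_tendsto_of_tendsto ((hu.const_mul B).const_sub (-meanPotential T Φ c - ε)) hact
    hlow
  linarith

theorem exists_nonconstant_isPeriodicSolution (hT : 0 < T) (hS : IsCompact S)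
    (hAP : IsAdmissible T S A Φ)
    (hb : ∃ b ∈ maxSet T S Φ, ∃ t, timeDeriv A t b ≠ -gradient (Φ t) b) :
    ∃ q : ℝ → Space, IsPeriodicSolution T S A Φ q ∧ ¬ ∃ c, ∀ t, q t = c := by
  obtain ⟨b, ⟨hbS, hbmax⟩, t₁, ht₁⟩ := hb
  have hA := hAP.vector
  have hΦ := hAP.scalar
  have hSc := hS.isClosed
  set V : Set ℝ := {a | ∃ q u, IsLoop T S q u ∧ action T A Φ q u = a} with hV
  have hVne : V.Nonempty := ⟨_, _, _, isLoop_const hbS, rfl⟩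
  have hVbdd : BddBelow V := by
    obtain ⟨m, hm⟩ := exists_le_action hT hA hΦ hSc
    exact ⟨m, by rintro _ ⟨q, u, h, rfl⟩; exact hm q u h⟩
  set m := sInf V with hmdef
  have hm : ∀ q u, IsLoop T S q u → m ≤ action T A Φ q u := fun q u h =>
    csInf_le hVbdd ⟨q, u, h, rfl⟩
  have hmb : m < -meanPotential T Φ b := by
    have h1 := hm _ _ (isLoop_const hbS)
    rw [action_const] at h1
    -- In case of equality the constant sequence `b` is minimizing within the compact set `{b}`, so
    -- `b` is itself a periodic solution, contrary to the hypothesis on the electric field.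
    refine lt_of_le_of_ne h1 fun heq => ?_
    obtain ⟨φ, q₀, P, -, hext, hlim, -⟩ := exists_isExtremal hT hA hΦ hSc
      (isCompact_singleton (x := b)) (by simpa using hbS) hm (fun _ : ℕ => isLoop_const hbS)
      (fun _ _ _ => rfl) (by rw [action_const, heq]; exact tendsto_const_nhds)
    obtain ⟨r, hr, hrq⟩ := hext.exists_isPeriodicSolution hT hA hΦ hSc
    refine ht₁ (hr.timeDeriv_eq (fun t => ?_) t₁)
    obtain ⟨s, hs, hst⟩ := Function.Periodic.exists_mem_Ico₀ hr.periodic hT t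
    rw [hst, hrq s (Ico_subset_Icc_self hs)]
    exact tendsto_nhds_unique (hlim.tendsto_at (Ico_subset_Icc_self hs)) tendsto_const_nhds
  -- The midpoint of the gap leaves a positive tolerance for the estimate at infinity while staying
  -- above `m`.
  set m₁ := (m + -meanPotential T Φ b) / 2 with hm₁
  have hseq : ∀ n : ℕ, ∃ q u, IsLoop T S q u ∧
      action T A Φ q u < min m₁ (m + 1 / ((n : ℝ) + 1)) := fun n => by
    have h1 : 0 < 1 / ((n : ℝ) + 1) := by positivity
    obtain ⟨_, ⟨q, u, h, rfl⟩, hlt⟩ := exists_lt_of_csInf_lt hVne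
      (show sInf V < min m₁ (m + 1 / ((n : ℝ) + 1)) from lt_min (by linarith) (by linarith))
    exact ⟨q, u, h, hlt⟩
  choose q u hloop hlt using hseq
  have hact : Tendsto (fun n => action T A Φ (q n) (u n)) atTop (𝓝 m) := by
    refine tendsto_of_tendsto_of_tendsto_of_le_of_le tendsto_const_nhds
      (h := fun n : ℕ => m + 1 / ((n : ℝ) + 1)) ?_ (fun n => hm _ _ (hloop n))
      fun n => (hlt n).le.trans (min_le_right _ _)
    simpa using tendsto_one_div_add_atTop_nhds_zero_nat.const_add m
  have hle : ∀ n, action T A Φ (q n) (u n) < m₁ := fun n => (hlt n).trans_le (min_le_left _ _)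
  obtain ⟨R, hR⟩ := exists_le_action_of_le_norm hT hA hΦ hS
    (show 0 < -meanPotential T Φ b - m₁ by linarith)
  obtain ⟨δ, hδ, hdist⟩ := exists_le_dist_of_action_le hT hA hΦ hS m₁
  have hRn : ∀ n, ‖q n 0‖ < R := fun n => by
    by_contra hcon
    have h1 := hR _ _ (hloop n) (not_lt.1 hcon)
    have h2 := hbmax _ ((hloop n).mem 0 ⟨le_rfl, hT.le⟩)
    linarith [hle n]
  -- The minimizing loops live here: they start within `R`, travel at most `T`, and stay `δ` away
  -- from `S`.
  set C : Set Space := Metric.closedBall 0 (R + T) ∩ ⋂ y ∈ S, {x | δ ≤ dist x y} with hCdef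
  have hC : IsCompact C := (isCompact_closedBall _ _).inter_right
    (isClosed_biInter fun y _ => isClosed_le continuous_const (continuous_id.dist continuous_const))
  have hCS : C ⊆ Sᶜ := fun x hx hxS => by
    have := mem_iInter₂.1 hx.2 x hxS
    rw [mem_ofPred_eq, dist_self] at this
    linarith
  have hqC : ∀ n, ∀ t ∈ Icc 0 T, q n t ∈ C := fun n t ht => by
    refine ⟨?_, mem_iInter₂.2 fun y hy => hdist _ _ (hloop n) (hle n).le t ht y hy⟩
    have h1 := (hloop n).norm_sub_le ⟨le_rfl, hT.le⟩ ht
    rw [sub_zero, abs_of_nonneg ht.1] at h1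
    rw [mem_closedBall_zero_iff]
    linarith [norm_sub_norm_le (q n t) (q n 0), hRn n, ht.2]
  obtain ⟨φ, q₀, P, hφ, hext, hlim, hvel⟩ :=
    exists_isExtremal hT hA hΦ hSc hC hCS hm hloop hqC hact
  obtain ⟨r, hr, hrq⟩ := hext.exists_isPeriodicSolution hT hA hΦ hSc
  refine ⟨r, hr, fun ⟨c, hc⟩ => ?_⟩
  have hq₀c : ∀ t ∈ Icc 0 T, q₀ t = c := fun t ht => by rw [← hrq t ht, hc]
  have hP0 : ∀ t ∈ Icc 0 T, velocity (P t) = 0 := fun t ht =>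
    (uniqueDiffOn_Icc hT t ht).eq_deriv _ (hext.hasDerivAt t).hasDerivWithinAt
      ((hasDerivWithinAt_const t (Icc 0 T) c).congr hq₀c (hq₀c t ht))
  have hvel' : Tendsto (fun n => ∫ t in (0 : ℝ)..T, ‖u (φ n) t‖) atTop (𝓝 0) := by
    refine hvel.congr fun n => intervalIntegral.integral_congr fun t ht => ?_
    rw [uIcc_of_le hT.le] at ht
    simp only [hP0 t ht, sub_zero]
  have h1 := neg_meanPotential_le hT hA.contDiff hΦ hSc hC hCS (fun n => hloop (φ n))
    (fun n => hqC (φ n)) (hact.comp hφ.tendsto_atTop) (hlim.congr_right hq₀c) hvel'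
  have hcS : c ∈ Sᶜ := hc 0 ▸ hr.mem 0
  linarith [hbmax c hcS]

/-! ### The uniform speed bound when `S` is empty -/

lemma exists_bound_gradient (hT : 0 < T) (hΦ : IsScalarPotential T ∅ Φ) :
    ∃ c, 0 ≤ c ∧ ∀ t x, ‖gradient (Φ t) x‖ ≤ c := by
  obtain ⟨R, hR⟩ := hΦ.decay 1 one_pos
  obtain ⟨c, hc⟩ := (isCompact_Icc.prod (isCompact_closedBall (0 : Space) R))
    |>.exists_bound_of_continuousOn (s := Icc 0 T ×ˢ Metric.closedBall (0 : Space) R)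
    (hΦ.continuousOn_gradient.mono fun p _ => by simp)
  refine ⟨max c 1, by positivity, fun t x => ?_⟩
  rcases le_total R ‖x‖ with h | h
  · exact (hR t x (by simp) h).le.trans (le_max_right _ _)
  · have hper : Function.Periodic (fun t => gradient (Φ t) x) T := fun t =>
      hΦ.gradient_periodic isClosed_empty t (by simp)
    obtain ⟨s, hs, hst⟩ := hper.exists_mem_Ico₀ hT t
    rw [hst]
    exact (hc (s, x) ⟨Ico_subset_Icc_self hs, by simpa using h⟩).trans (le_max_left _ _)

/-- A periodic solution subject to a bounded force has bounded momentum. -/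
lemma IsPeriodicSolution.norm_momentum_le (hT : 0 < T) {q : ℝ → Space}
    (h : IsPeriodicSolution T S A Φ q) {c : ℝ}
    (hc : ∀ t, ‖electricField A Φ t (q t) + cross (deriv q t) (magneticField A t (q t))‖ ≤ c)
    (t : ℝ) : ‖momentum q t‖ ≤ c * T := by
  have hper : Function.Periodic q T := h.periodic
  have hd : ∀ s, HasDerivAt q (deriv q s) s := fun s =>
    (h.contDiff.differentiable (by norm_num) s).hasDerivAt
  set f : ℝ → ℝ := fun s => ⟪momentum q t, q s⟫ with hf
  have hfd : ∀ s, HasDerivAt f ⟪momentum q t, deriv q s⟫ s := fun s => by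
    simpa using (hasDerivAt_const s (momentum q t)).inner ℝ (hd s)
  have hff : f (t - T) = f t := by
    have := hper (t - T)
    rw [sub_add_cancel] at this
    simp only [hf, this]
  -- Rolle over one period finds a time `s` at which the momentum is orthogonal to the fixed vector
  -- `momentum q t`, so `‖momentum q t‖²` is the pairing of that vector with the momentum increment
  -- from `s` to `t`.
  obtain ⟨s, hs, hs0⟩ := exists_hasDerivAt_eq_zero (show t - T < t by linarith)
    (fun s _ => (hfd s).continuousAt.continuousWithinAt) hff fun s _ => hfd s
  have h1 : ‖momentum q t - momentum q s‖ ≤ c * ‖t - s‖ :=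
    convex_univ.norm_image_sub_le_of_norm_hasDerivWithin_le
      (fun r _ => (h.equation r).hasDerivWithinAt) (fun r _ => hc r) (mem_univ s) (mem_univ t)
  have h2 : ⟪momentum q t, momentum q s⟫ = 0 := by
    rw [momentum.eq_1 q s, inner_smul_right, hs0, mul_zero]
  have h3 : ‖momentum q t‖ * ‖momentum q t‖ ≤ ‖momentum q t‖ * ‖momentum q t - momentum q s‖ := by
    have := real_inner_le_norm (momentum q t) (momentum q t - momentum q s)
    rwa [inner_sub_right, h2, sub_zero, real_inner_self_eq_norm_mul_norm] at this
  have hc0 : 0 ≤ c := (norm_nonneg _).trans (hc 0)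
  have h4 : ‖t - s‖ ≤ T := by
    rw [Real.norm_of_nonneg (by linarith [hs.2])]
    linarith [hs.1]
  have h5 : c * ‖t - s‖ ≤ c * T := mul_le_mul_of_nonneg_left h4 hc0
  rcases (norm_nonneg (momentum q t)).eq_or_lt with h6 | h6
  · rw [← h6]; positivity
  · exact ((le_of_mul_le_mul_left h3 h6).trans h1).trans h5

theorem exists_speed_bound (hT : 0 < T) (hA : IsVectorPotential T A)
    (hΦ : IsScalarPotential T ∅ Φ) :
    ∃ ρ : ℝ, 0 < ρ ∧ ρ < 1 ∧ ∀ q : ℝ → Space, IsPeriodicSolution T ∅ A Φ q →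
      (⨆ t, ‖deriv q t‖) < ρ := by
  obtain ⟨a, ha0, ha⟩ := hA.exists_bound hT
  obtain ⟨g, hg0, hg⟩ := exists_bound_gradient hT hΦ
  -- The bound `a` enters twice, through the adjoint term and through the total derivative of `A`.
  -- Below, `σ` is the speed belonging to momentum of size `k`.
  set k := (2 * a + g) * T with hk
  have hk0 : 0 ≤ k := by positivity
  set σ := √(1 - (1 + k ^ 2)⁻¹) with hσ
  have hσ0 : 0 ≤ σ := Real.sqrt_nonneg _
  have hσ1 : σ < 1 := by
    rw [hσ, Real.sqrt_lt' one_pos]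
    have : 0 < (1 + k ^ 2)⁻¹ := by positivity
    linarith
  -- The midpoint makes the inequality for the supremum strict and the bound positive even if `σ =
  -- 0`.
  refine ⟨(σ + 1) / 2, by linarith, by linarith, fun q h => ?_⟩
  have hle : ∀ t, ‖deriv q t‖ ≤ σ := by
    intro t
    have hp : ‖momentum q t‖ ≤ k := by
      refine h.norm_momentum_le hT (fun s => ?_) t
      rw [electricField_add_cross, force]
      have h1 := ha s (q s)
      have h2 := hg s (q s)
      have h3 := (h.speed s).le
      have h4 : ‖ContinuousLinearMap.adjoint (fderiv ℝ (A s) (q s)) (deriv q s)‖ ≤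
          ‖fderiv ℝ (A s) (q s)‖ := by
        have := ContinuousLinearMap.unit_le_opNorm
          (ContinuousLinearMap.adjoint (fderiv ℝ (A s) (q s))) _ h3
        rwa [LinearIsometryEquiv.norm_map] at this
      have h5 := ContinuousLinearMap.unit_le_opNorm (fderiv ℝ (A s) (q s)) _ h3
      have h6 := norm_sub_le (ContinuousLinearMap.adjoint (fderiv ℝ (A s) (q s)) (deriv q s) -
        gradient (Φ s) (q s)) (timeDeriv A s (q s) + fderiv ℝ (A s) (q s) (deriv q s))
      have h7 := norm_sub_le (ContinuousLinearMap.adjoint (fderiv ℝ (A s) (q s)) (deriv q s))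
        (gradient (Φ s) (q s))
      have h8 := norm_add_le (timeDeriv A s (q s)) (fderiv ℝ (A s) (q s) (deriv q s))
      linarith [norm_nonneg (timeDeriv A s (q s))]
    rw [← velocity_momentum (h.speed t)]
    refine Real.le_sqrt_of_sq_le ?_
    rw [norm_velocity_sq]
    have h1 : ‖momentum q t‖ ^ 2 ≤ k ^ 2 := pow_le_pow_left₀ (norm_nonneg _) hp 2
    have h2 : (1 + k ^ 2)⁻¹ ≤ (1 + ‖momentum q t‖ ^ 2)⁻¹ :=
      inv_anti₀ (by positivity) (by linarith)
    change 1 - (1 + ‖momentum q t‖ ^ 2)⁻¹ ≤ _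
    linarith
  exact (ciSup_le hle).trans_lt (by linarith)

end Main

end LorentzForce

end

theorem mainTheorem3 (T : ℝ) (hT : 0 < T)
    (S : Set LorentzForce.Space) (hS : IsCompact S)
    (A : ℝ → LorentzForce.Space → LorentzForce.Space) (Φ : ℝ → LorentzForce.Space → ℝ)
    (hAP : LorentzForce.IsAdmissible T S A Φ)
    (hb : ∃ b ∈ LorentzForce.maxSet T S Φ,
      ∃ t, LorentzForce.timeDeriv A t b ≠ -gradient (Φ t) b) :
    (∃ q : ℝ → LorentzForce.Space, LorentzForce.IsPeriodicSolution T S A Φ q ∧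
      ¬ ∃ c, ∀ t, q t = c) ∧
    (S = ∅ → ∃ ρ : ℝ, 0 < ρ ∧ ρ < 1 ∧
      ∀ q : ℝ → LorentzForce.Space, LorentzForce.IsPeriodicSolution T S A Φ q →
        (⨆ t, ‖deriv q t‖) < ρ) := by
  refine ⟨LorentzForce.exists_nonconstant_isPeriodicSolution hT hS hAP hb, ?_⟩
  rintro rfl
  exact LorentzForce.exists_speed_bound hT hAP.vector hAP.scalar
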